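/- **Setting.** All locally convex spaces are real and Hausdorff. A map $h:U\to F$ on an open subset $U$ of a locally convex space $E$ is *smooth* if it is continuous and all iterated directional derivatives $\mathsf d^jh(p)(v_1,\dots,v_j)$ exist and are continuous on $U\times E^j$; it is *analytic* if it is continuous and near every $p\in U$ one has $h(p+v)=\sum_{n\ge 0}h_n(v)$ with continuous homogeneous polynomials $h_n$ of degree $n$. Manifolds, maps between them and Lie groups modelled on locally convex spaces are understood in this sense; $G$ has an exponential map $x\mapsto e^x$. A *Harish–Chandra pair* $(G,\mathfrak g)$ consists of a Lie group $G$ and a $\mathbb Z_2$-graded locally convex space $\mathfrak g=\mathfrak g_{\bar 0}\oplus\mathfrak g_{\bar 1}$ with a continuous Lie superbracket such that $\mathfrak g_{\bar 0}=\mathrm{Lie}(G)$, together with a homomorphism $\mathrm{Ad}$ from $G$ to the group of grading-preserving automorphisms of $\mathfrak g$ such that $(g,x)\mapsto\mathrm{Ad}(g)x$ is smooth and the derivative of $g\mapsto\mathrm{Ad}(g)y$ at $\mathbf 1_G$ in the direction $x\in\mathfrak g_{\bar 0}$ is $[x,y]$ for all $y\in\mathfrak g$. It is *analytic* if $G$ is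 an analytic Lie group and $(g,x)\mapsto \mathrm{Ad}(g)x$ is analytic. A *smooth* (resp., for an analytic pair, *analytic*) *unitary representation* $(\pi,\rho^\pi,\mathscr H)$ of $(G,\mathfrak g)$ consists of a unitary representation $\pi$ of $G$ by grading-preserving operators on a Hilbert space with orthogonal grading $\mathscr H=\mathscr H_{\bar 0}\oplus\mathscr H_{\bar 1}$, such that the space $\mathscr B=\mathscr H^\infty$ (resp. $\mathscr B=\mathscr H^\omega$) of vectors with smooth (resp. analytic) orbit map is dense, and a representation $\rho^\pi:\mathfrak g\to\mathrm{End}_{\mathbb C}(\mathscr B)$ of the Lie superalgebra $\mathfrak g$ such that: $\rho^\pi(x)$ is the restriction to $\mathscr B$ of the infinitesimal generator of $t\mapsto\pi(e^{tx})$ for $x\in\mathfrak g_{\bar 0}$; $e^{-\pi i/4}\rho^\pi(x)$ is symmetric for $x\in\mathfrak g_{\bar 1}$; and every coset of the identity component of $G$ contains some $g$ with $\pi(g)\rho^\pi(x)\pi(g)^{-1}=\rho^\pi(\mathrm{Ad}(g)x)$ for all $x\in\mathfrak g_{\bar 1}$. Extend $\rho^\pi$ to the enveloping algebra $U(\mathfrak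 g_{\mathbb C})$ of the complexified Lie superalgebra. Let $C^\infty(G,\mathfrak g)$ (resp. $C^\omega(G,\mathfrak g)$) be the set of $\mathbb C$-linear maps $f:U(\mathfrak g_{\mathbb C})\to C^\infty(G,\mathbb C)$ such that $f(xD)(g)=\frac{d}{dt}\big|_{t=0}f(D)(ge^{tx})$ for $x\in\mathfrak g_{\bar 0}$, $D\in U(\mathfrak g_{\mathbb C})$, $g\in G$, and such that for every $n\ge 0$ the map $\mathfrak g^n\times G\to\mathbb C$, $(x_1,\dots,x_n,g)\mapsto f(x_1\cdots x_n)(g)$ is smooth (resp. analytic). Such an $f$ is *even* if $f(D)=0$ for every odd $D\in U(\mathfrak g_{\mathbb C})$. **Proposition.** Let $(G,\mathfrak g)$ be a Harish–Chandra pair such that $\mathfrak g$ is a Fréchet space. (i) Let $(\pi,\rho^\pi,\mathscr H)$ be a smooth unitary representation of $(G,\mathfrak g)$ and let $v,w\in\mathscr H^\infty$ be homogeneous vectors of equal parity. Then there is an even $f\in C^\infty(G,\mathfrak g)$ such that $f(D)(g)=\langle\pi(g)\rho^\pi(D)v,w\rangle$ for all $g\in G$ and $D\in U(\mathfrak g_{\mathbb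 C})$. (ii) Assume that $(G,\mathfrak g)$ is an analytic Harish–Chandra pair. Let $(\pi,\rho^\pi,\mathscr H)$ be an analytic unitary representation of $(G,\mathfrak g)$ and let $v,w\in\mathscr H^\omega$ be homogeneous vectors of equal parity. Then there is an even $f\in C^\omega(G,\mathfrak g)$ such that $f(D)(g)=\langle\pi(g)\rho^\pi(D)v,w\rangle$ for all $g\in G$ and $D\in U(\mathfrak g_{\mathbb C})$. -/

import Mathlib

open Topology Filter Set
open scoped TensorProduct

namespace SuperRep

/-! ## Calculus on locally convex spaces -/

section Calculus

variable {E F : Type*}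
  [AddCommGroup E] [Module ℝ E] [TopologicalSpace E]
  [AddCommGroup F] [Module ℝ F] [TopologicalSpace F]

/-- `f` is smooth on the (open) set `U`: it is continuous, and all iterated directional derivatives
`d^j f(p)(v₁, …, v_j)`, where `d^(j+1) f(p)(v₁, …, v_(j+1))` is the derivative at `t = 0` of
`d^j f(p + t v_(j+1))(v₁, …, v_j)`, exist and are jointly continuous on `U × E^j`. -/
def SmoothOn (f : E → F) (U : Set E) : Prop :=
  ∃ D : (j : ℕ) → E → (Fin j → E) → F,
    (∀ p ∈ U, ∀ v, D 0 p v = f p) ∧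
    (∀ j, ∀ p ∈ U, ∀ v : Fin (j + 1) → E,
      Tendsto
        (fun t : ℝ => t⁻¹ • (D j (p + t • v (Fin.last j)) (Fin.init v) - D j p (Fin.init v)))
        (𝓝[≠] 0) (𝓝 (D (j + 1) p v))) ∧
    (∀ j, ContinuousOn (fun q : E × (Fin j → E) => D j q.1 q.2) (U ×ˢ univ))

/-- `f` is analytic on the (open) set `U`: it is continuous, and near every `p ∈ U` it is the sum
of a series of continuous homogeneous polynomials. (A `0`-neighbourhood of `E` is the same thing as
the trace on `E` of a `0`-neighbourhood of the complexification of `E`.) -/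
def AnalyticOn (f : E → F) (U : Set E) : Prop :=
  ContinuousOn f U ∧
    ∀ p ∈ U, ∃ V ∈ 𝓝 (0 : E), ∃ β : (n : ℕ) → ContinuousMultilinearMap ℝ (fun _ : Fin n => E) F,
      ∀ v ∈ V, HasSum (fun n => β n (fun _ => v)) (f (p + v))

/-- The two kinds of regularity considered: `C^∞` and `C^ω`. -/
inductive Regularity
  | smooth
  | analytic

/-- Smoothness or analyticity on an open subset of a locally convex space. -/
def RegOn : Regularity → (E → F) → Set E → Prop
  | .smooth, f, U => SmoothOn f U
  | .analytic, f, U => AnalyticOn f U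

end Calculus

/-! ## Manifolds and Lie groups modelled on locally convex spaces -/

section Manifolds

variable {E F M N : Type*}
  [AddCommGroup E] [Module ℝ E] [TopologicalSpace E]
  [AddCommGroup F] [Module ℝ F] [TopologicalSpace F]
  [TopologicalSpace M] [TopologicalSpace N]

/-- The atlas of a locally convex space, regarded as a manifold. -/
def selfAtlas (E : Type*) [TopologicalSpace E] : Set (OpenPartialHomeomorph E E) :=
  {OpenPartialHomeomorph.refl E}

/-- The product atlas. -/
def prodAtlas {E F M N : Type*} [TopologicalSpace E] [TopologicalSpace F] [TopologicalSpace M]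
    [TopologicalSpace N] (A : Set (OpenPartialHomeomorph M E))
    (B : Set (OpenPartialHomeomorph N F)) : Set (OpenPartialHomeomorph (M × N) (E × F)) :=
  Set.image2 (fun φ ψ => φ.prod ψ) A B

/-- Smooth or analytic maps between manifolds with atlases `A` and `B`: continuous maps that are
smooth or analytic in all charts. -/
def RegMap (r : Regularity) (A : Set (OpenPartialHomeomorph M E))
    (B : Set (OpenPartialHomeomorph N F)) (f : M → N) : Prop :=
  Continuous f ∧ ∀ φ ∈ A, ∀ ψ ∈ B,
    RegOn r (ψ ∘ f ∘ φ.symm) (φ.target ∩ φ.symm ⁻¹' (f ⁻¹' ψ.source))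

/-- `G`, with its atlas of charts with values in `E`, is a smooth (analytic) Lie group. -/
structure IsLieGroup (r : Regularity) (E G : Type*) [AddCommGroup E] [Module ℝ E]
    [TopologicalSpace E] [Group G] [TopologicalSpace G] [ChartedSpace E G] : Prop where
  compatible : ∀ φ ∈ atlas E G, ∀ ψ ∈ atlas E G,
    RegOn r (ψ ∘ φ.symm) (φ.target ∩ φ.symm ⁻¹' ψ.source)
  regular_mul : RegMap r (prodAtlas (atlas E G) (atlas E G)) (atlas E G) (fun p : G × G => p.1 * p.2)
  regular_inv : RegMap r (atlas E G) (atlas E G) (fun g : G => g⁻¹)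

variable {G : Type*} [Group G] [TopologicalSpace G] [ChartedSpace E G]

/-- The tangent space of `G` at `1` is identified with the model space `E` by means of the preferred
chart `φ` at `1`. `HasTangentDeriv c x z` says that `d_x c (1) = z`, the derivative at the unit
element of `c : G → F` in the direction `x`. -/
def HasTangentDeriv (c : G → F) (x : E) (z : F) : Prop :=
  Tendsto
    (fun t : ℝ =>
      t⁻¹ • (c ((chartAt E (1 : G)).symm (chartAt E (1 : G) 1 + t • x)) - c 1))
    (𝓝[≠] 0) (𝓝 z)

/-- `b` is the Lie bracket of `Lie(G) = T_1 G = E`, i.e. `b x y = d_x (Ad_G(·) y)(1)` where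
`Ad_G(g)` is the derivative at `1` of the conjugation `h ↦ g h g⁻¹`. -/
def IsLieGroupBracket (E G : Type*) [AddCommGroup E] [Module ℝ E]
    [TopologicalSpace E] [Group G] [TopologicalSpace G] [ChartedSpace E G] (b : E → E → E) : Prop :=
  ∃ adG : G → E → E,
    (∀ g y, HasTangentDeriv (fun h : G => chartAt E (1 : G) (g * h * g⁻¹)) y (adG g y)) ∧
    (∀ x y, HasTangentDeriv (fun g : G => adG g y) x (b x y))

/-- `e` is the exponential map of `G`: for every `x`, the map `t ↦ e (t x)` is the smooth
one-parameter subgroup whose velocity at `t = 0` is `x`. -/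
structure IsExpMap (e : E → G) : Prop where
  add : ∀ (x : E) (s t : ℝ), e ((s + t) • x) = e (s • x) * e (t • x)
  smooth : ∀ x : E, RegMap .smooth (selfAtlas ℝ) (atlas E G) (fun t : ℝ => e (t • x))
  velocity : ∀ x : E,
    Tendsto (fun t : ℝ => t⁻¹ • (chartAt E (1 : G) (e (t • x)) - chartAt E (1 : G) 1))
      (𝓝[≠] 0) (𝓝 x)

end Manifolds

/-! ## Lie superalgebras and their enveloping algebras -/

section Superalgebra

/-- The homogeneous part of parity `i` of the `ℤ/2`-graded space `𝔤₀ × 𝔤₁`. -/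
def homog (𝔤₀ 𝔤₁ : Type*) [AddCommGroup 𝔤₀] [Module ℝ 𝔤₀] [AddCommGroup 𝔤₁] [Module ℝ 𝔤₁]
    (i : ZMod 2) : Submodule ℝ (𝔤₀ × 𝔤₁) :=
  if i = 0 then LinearMap.range (LinearMap.inl ℝ 𝔤₀ 𝔤₁)
  else LinearMap.range (LinearMap.inr ℝ 𝔤₀ 𝔤₁)

/-- The sign `(-1)^(ij)`. -/
def sgn (i j : ZMod 2) : ℤ := if i = 1 ∧ j = 1 then -1 else 1

/-- A Lie superalgebra structure with continuous bracket on the `ℤ/2`-graded topological vector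
space `𝔤 = 𝔤₀ ⊕ 𝔤₁`. -/
structure LieSuperalgebra (𝔤₀ 𝔤₁ : Type*)
    [AddCommGroup 𝔤₀] [Module ℝ 𝔤₀] [TopologicalSpace 𝔤₀]
    [AddCommGroup 𝔤₁] [Module ℝ 𝔤₁] [TopologicalSpace 𝔤₁] where
  br : (𝔤₀ × 𝔤₁) →ₗ[ℝ] (𝔤₀ × 𝔤₁) →ₗ[ℝ] (𝔤₀ × 𝔤₁)
  br_mem : ∀ i j, ∀ x ∈ homog 𝔤₀ 𝔤₁ i, ∀ y ∈ homog 𝔤₀ 𝔤₁ j, br x y ∈ homog 𝔤₀ 𝔤₁ (i + j)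
  skew : ∀ i j, ∀ x ∈ homog 𝔤₀ 𝔤₁ i, ∀ y ∈ homog 𝔤₀ 𝔤₁ j, br x y = -(sgn i j • br y x)
  jacobi : ∀ i j k, ∀ x ∈ homog 𝔤₀ 𝔤₁ i, ∀ y ∈ homog 𝔤₀ 𝔤₁ j, ∀ z ∈ homog 𝔤₀ 𝔤₁ k,
    br x (br y z) = br (br x y) z + sgn i j • br y (br x z)
  continuous_br : Continuous (fun p : (𝔤₀ × 𝔤₁) × (𝔤₀ × 𝔤₁) => br p.1 p.2)

variable {𝔤₀ 𝔤₁ : Type*}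
  [AddCommGroup 𝔤₀] [Module ℝ 𝔤₀] [TopologicalSpace 𝔤₀]
  [AddCommGroup 𝔤₁] [Module ℝ 𝔤₁] [TopologicalSpace 𝔤₁]

namespace LieSuperalgebra

variable (L : LieSuperalgebra 𝔤₀ 𝔤₁)

/-- The inclusion of `𝔤` into the tensor algebra of its complexification. -/
noncomputable def tensorι (x : 𝔤₀ × 𝔤₁) : TensorAlgebra ℂ (ℂ ⊗[ℝ] (𝔤₀ × 𝔤₁)) :=
  TensorAlgebra.ι ℂ ((1 : ℂ) ⊗ₜ[ℝ] x)

/-- The relations `x y = (-1)^(|x||y|) y x + [x, y]` for homogeneous `x, y ∈ 𝔤`. As the bracket of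
`𝔤_ℂ` is the complex bilinear extension, they imply those for homogeneous `x, y ∈ 𝔤_ℂ`. -/
inductive EnvRel : TensorAlgebra ℂ (ℂ ⊗[ℝ] (𝔤₀ × 𝔤₁)) → TensorAlgebra ℂ (ℂ ⊗[ℝ] (𝔤₀ × 𝔤₁)) → Prop
  | comm (i j : ZMod 2) (x y : 𝔤₀ × 𝔤₁) (hx : x ∈ homog 𝔤₀ 𝔤₁ i) (hy : y ∈ homog 𝔤₀ 𝔤₁ j) :
      EnvRel (tensorι x * tensorι y) (sgn i j • (tensorι y * tensorι x) + tensorι (L.br x y))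

/-- The universal enveloping algebra `U(𝔤_ℂ)`. -/
abbrev Env : Type _ := RingQuot (EnvRel L)

/-- The canonical map `𝔤 → U(𝔤_ℂ)`. -/
noncomputable def ι (x : 𝔤₀ × 𝔤₁) : L.Env := RingQuot.mkAlgHom ℂ (EnvRel L) (tensorι x)

/-- The monomial `x₁ ⋯ x_n ∈ U(𝔤_ℂ)`. -/
noncomputable def monomial {n : ℕ} (x : Fin n → 𝔤₀ × 𝔤₁) : L.Env :=
  (List.ofFn (fun k => L.ι (x k))).prod

/-- The part of parity `i` of the superalgebra `U(𝔤_ℂ)`, spanned by the monomials in homogeneous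
elements whose parities add up to `i`. -/
noncomputable def envParity (i : ZMod 2) : Submodule ℂ L.Env :=
  Submodule.span ℂ
    {D | ∃ (n : ℕ) (p : Fin n → ZMod 2) (x : Fin n → 𝔤₀ × 𝔤₁),
      (∀ k, x k ∈ homog 𝔤₀ 𝔤₁ (p k)) ∧ ∑ k, p k = i ∧ D = L.monomial x}

/-- `ρ` satisfies `ρ([x, y]) = ρ(x) ρ(y) - (-1)^(|x||y|) ρ(y) ρ(x)`. -/
def IsBracketHom {A : Type*} [Ring A] [Algebra ℂ A] (ρ : (𝔤₀ × 𝔤₁) →ₗ[ℝ] A) : Prop :=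
  ∀ i j, ∀ x ∈ homog 𝔤₀ 𝔤₁ i, ∀ y ∈ homog 𝔤₀ 𝔤₁ j,
    ρ (L.br x y) = ρ x * ρ y - sgn i j • (ρ y * ρ x)

/-- The extension to `U(𝔤_ℂ)` of a homomorphism of Lie superalgebras from `𝔤` to a complex
associative algebra. -/
noncomputable def envLift {A : Type*} [Ring A] [Algebra ℂ A]
    (ρ : (𝔤₀ × 𝔤₁) →ₗ[ℝ] A) (hρ : L.IsBracketHom ρ) : L.Env →ₐ[ℂ] A :=
  RingQuot.liftAlgHom ℂ
    ⟨TensorAlgebra.lift ℂ (LinearMap.liftBaseChange ℂ ρ), by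
      rintro _ _ ⟨i, j, x, y, hx, hy⟩
      simp [tensorι, hρ i j x hx y hy]⟩

theorem envLift_ι {A : Type*} [Ring A] [Algebra ℂ A]
    (ρ : (𝔤₀ × 𝔤₁) →ₗ[ℝ] A) (hρ : L.IsBracketHom ρ) (x : 𝔤₀ × 𝔤₁) :
    L.envLift ρ hρ (L.ι x) = ρ x := by
  simp [envLift, ι, tensorι]

end LieSuperalgebra

end Superalgebra

/-! ## Harish-Chandra pairs -/

section HarishChandra

/-- A Harish-Chandra pair `(G, 𝔤)`, `𝔤 = 𝔤₀ ⊕ 𝔤₁`, with the exponential map of `G`. The Lie group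
`G` is modelled on `𝔤₀`, which is identified with `Lie(G) = T_1 G` by the preferred chart at `1`. -/
structure HarishChandraPair (G 𝔤₀ 𝔤₁ : Type*)
    [AddCommGroup 𝔤₀] [Module ℝ 𝔤₀] [TopologicalSpace 𝔤₀]
    [AddCommGroup 𝔤₁] [Module ℝ 𝔤₁] [TopologicalSpace 𝔤₁]
    [Group G] [TopologicalSpace G] [ChartedSpace 𝔤₀ G] where
  isLieGroup : IsLieGroup .smooth 𝔤₀ G
  exp : 𝔤₀ → G
  isExpMap : IsExpMap exp
  L : LieSuperalgebra 𝔤₀ 𝔤₁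
  bracket_even : IsLieGroupBracket 𝔤₀ G (fun x y => (L.br (x, 0) (y, 0)).1)
  Ad : G →* ((𝔤₀ × 𝔤₁) ≃ₗ[ℝ] (𝔤₀ × 𝔤₁))
  Ad_homog : ∀ g i, ∀ x ∈ homog 𝔤₀ 𝔤₁ i, Ad g x ∈ homog 𝔤₀ 𝔤₁ i
  Ad_br : ∀ g x y, Ad g (L.br x y) = L.br (Ad g x) (Ad g y)
  smooth_Ad : RegMap .smooth (prodAtlas (atlas 𝔤₀ G) (selfAtlas (𝔤₀ × 𝔤₁))) (selfAtlas (𝔤₀ × 𝔤₁))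
    (fun p : G × (𝔤₀ × 𝔤₁) => Ad p.1 p.2)
  deriv_Ad : ∀ (x : 𝔤₀) (y : 𝔤₀ × 𝔤₁), HasTangentDeriv (fun g : G => Ad g y) x (L.br (x, 0) y)

variable {G 𝔤₀ 𝔤₁ : Type*}
  [AddCommGroup 𝔤₀] [Module ℝ 𝔤₀] [TopologicalSpace 𝔤₀]
  [AddCommGroup 𝔤₁] [Module ℝ 𝔤₁] [TopologicalSpace 𝔤₁]
  [Group G] [TopologicalSpace G] [ChartedSpace 𝔤₀ G]

/-- Analytic Harish-Chandra pairs. -/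
structure HarishChandraPair.IsAnalytic (P : HarishChandraPair G 𝔤₀ 𝔤₁) : Prop where
  isLieGroup : IsLieGroup .analytic 𝔤₀ G
  analytic_Ad : RegMap .analytic (prodAtlas (atlas 𝔤₀ G) (selfAtlas (𝔤₀ × 𝔤₁)))
    (selfAtlas (𝔤₀ × 𝔤₁)) (fun p : G × (𝔤₀ × 𝔤₁) => P.Ad p.1 p.2)

/-- `C^∞(G, 𝔤)` (`r = smooth`) and `C^ω(G, 𝔤)` (`r = analytic`): the `ℂ`-linear maps
`f : U(𝔤_ℂ) → C^∞(G, ℂ)` with `f(x D)(g) = L_x (f(D))(g)`, the derivative at `t = 0` of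
`f(D)(g e^(t x))`, for `x ∈ 𝔤₀`, and such that all the maps
`(x₁, …, x_n, g) ↦ f(x₁ ⋯ x_n)(g)` are smooth (analytic) on `𝔤^n × G`. -/
structure Superfunction (r : Regularity) (P : HarishChandraPair G 𝔤₀ 𝔤₁) where
  toFun : P.L.Env →ₗ[ℂ] (G → ℂ)
  smooth_apply : ∀ D, RegMap .smooth (atlas 𝔤₀ G) (selfAtlas ℂ) (toFun D)
  left_invariant : ∀ (x : 𝔤₀) (D : P.L.Env) (g : G),
    HasDerivAt (fun t : ℝ => toFun D (g * P.exp (t • x))) (toFun (P.L.ι (x, 0) * D) g) 0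
  regular : ∀ n : ℕ,
    RegMap r (prodAtlas (selfAtlas (Fin n → 𝔤₀ × 𝔤₁)) (atlas 𝔤₀ G)) (selfAtlas ℂ)
      (fun p : (Fin n → 𝔤₀ × 𝔤₁) × G => toFun (P.L.monomial p.1) p.2)

/-- The function on (the underlying set `G × U(𝔤_ℂ)` of) the monoid `G ⋉ U(𝔤_ℂ)` defined by a
superfunction. -/
noncomputable def Superfunction.breve {r : Regularity} {P : HarishChandraPair G 𝔤₀ 𝔤₁}
    (f : Superfunction r P) : G × P.L.Env → ℂ :=
  fun s => f.toFun s.2 s.1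

/-- Even superfunctions vanish on all `(g, D)` with `D` odd. -/
def Superfunction.IsEven {r : Regularity} {P : HarishChandraPair G 𝔤₀ 𝔤₁}
    (f : Superfunction r P) : Prop :=
  ∀ g : G, ∀ D ∈ P.L.envParity 1, f.breve (g, D) = 0

end HarishChandra

/-! ## Unitary representations -/

section Representations

section Closure

variable {E F : Type*}
  [AddCommGroup E] [Module ℝ E] [TopologicalSpace E]
  [NormedAddCommGroup F] [NormedSpace ℂ F]

theorem RegOn.add {r : Regularity} {f g : E → F} {U : Set E} (hf : RegOn r f U)
    (hg : RegOn r g U) : RegOn r (fun x => f x + g x) U := by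
  cases r with
  | smooth =>
    obtain ⟨D, h0, h1, h2⟩ := hf
    obtain ⟨D', h0', h1', h2'⟩ := hg
    refine ⟨fun j p v => D j p v + D' j p v, fun p hp v => by simp [h0 p hp, h0' p hp],
      fun j p hp v => ?_, fun j => (h2 j).add (h2' j)⟩
    refine ((h1 j p hp v).add (h1' j p hp v)).congr fun t => ?_
    rw [← smul_add, sub_add_sub_comm]
  | analytic =>
    refine ⟨hf.1.add hg.1, fun p hp => ?_⟩
    obtain ⟨V, hV, β, h⟩ := hf.2 p hp
    obtain ⟨V', hV', β', h'⟩ := hg.2 p hp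
    exact ⟨V ∩ V', inter_mem hV hV', fun n => β n + β' n,
      fun v hv => (h v hv.1).add (h' v hv.2)⟩

theorem RegOn.const_smul {r : Regularity} {f : E → F} {U : Set E} (hf : RegOn r f U) (c : ℂ) :
    RegOn r (fun x => c • f x) U := by
  cases r with
  | smooth =>
    obtain ⟨D, h0, h1, h2⟩ := hf
    refine ⟨fun j p v => c • D j p v, fun p hp v => by simp [h0 p hp],
      fun j p hp v => ?_, fun j => (h2 j).const_smul c⟩
    refine ((h1 j p hp v).const_smul c).congr fun t => ?_
    rw [← smul_sub, smul_comm]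
  | analytic =>
    refine ⟨hf.1.const_smul c, fun p hp => ?_⟩
    obtain ⟨V, hV, β, h⟩ := hf.2 p hp
    exact ⟨V, hV, fun n => c • β n, fun v hv => (h v hv).const_smul c⟩

theorem RegOn.zero (r : Regularity) (U : Set E) : RegOn r (fun _ : E => (0 : F)) U := by
  cases r with
  | smooth =>
    exact ⟨fun _ _ _ => 0, fun _ _ _ => rfl, fun j p _ v => by simp, fun j => continuousOn_const⟩
  | analytic =>
    exact ⟨continuousOn_const, fun p _ => ⟨univ, univ_mem, fun _ => 0, fun v _ => by
      simp⟩⟩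

end Closure

/-- The space `H^∞` (`H^ω`) of vectors whose orbit map `G → H`, `g ↦ π(g) v` is smooth (analytic);
`E` is the model space of `G`. -/
def regVectors (r : Regularity) (E : Type*) {G H : Type*} [AddCommGroup E] [Module ℝ E]
    [TopologicalSpace E] [Group G] [TopologicalSpace G] [ChartedSpace E G]
    [NormedAddCommGroup H] [InnerProductSpace ℂ H] (π : G →* (H ≃ₗᵢ[ℂ] H)) : Submodule ℂ H where
  carrier := {v | RegMap r (atlas E G) (selfAtlas H) (fun g : G => π g v)}
  add_mem' := by
    rintro v w ⟨hv, hv'⟩ ⟨hw, hw'⟩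
    refine ⟨by simpa using! hv.add hw, fun φ hφ ψ hψ => ?_⟩
    have h1 := hv' φ hφ ψ hψ
    have h2 := hw' φ hφ ψ hψ
    obtain rfl : ψ = OpenPartialHomeomorph.refl H := hψ
    simpa [Function.comp_def] using RegOn.add h1 h2
  zero_mem' := by
    refine ⟨by simpa using continuous_const, fun φ hφ ψ hψ => ?_⟩
    obtain rfl : ψ = OpenPartialHomeomorph.refl H := hψ
    simpa [Function.comp_def] using RegOn.zero r _
  smul_mem' := by
    rintro c v ⟨hv, hv'⟩
    refine ⟨by simpa using! hv.const_smul c, fun φ hφ ψ hψ => ?_⟩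
    have h1 := hv' φ hφ ψ hψ
    obtain rfl : ψ = OpenPartialHomeomorph.refl H := hψ
    simpa [Function.comp_def] using RegOn.const_smul h1 c

/-- A `ℤ/2`-grading `H = H₀ ⊕ H₁` (orthogonal direct sum) of a Hilbert space. -/
structure HilbertGrading (H : Type*) [NormedAddCommGroup H] [InnerProductSpace ℂ H] where
  part : ZMod 2 → Submodule ℂ H
  orthogonal : ∀ v ∈ part 0, ∀ w ∈ part 1, inner ℂ v w = 0
  sup_eq_top : part 0 ⊔ part 1 = ⊤

variable {G 𝔤₀ 𝔤₁ : Type*}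
  [AddCommGroup 𝔤₀] [Module ℝ 𝔤₀] [TopologicalSpace 𝔤₀]
  [AddCommGroup 𝔤₁] [Module ℝ 𝔤₁] [TopologicalSpace 𝔤₁]
  [Group G] [TopologicalSpace G] [ChartedSpace 𝔤₀ G]

/-- A smooth (analytic) unitary representation `(π, ρ, H)` of a (analytic) Harish-Chandra pair;
`ρ` acts on `B = H^∞` (`B = H^ω`). -/
structure UnitaryRep (r : Regularity) (P : HarishChandraPair G 𝔤₀ 𝔤₁)
    (H : Type*) [NormedAddCommGroup H] [InnerProductSpace ℂ H] where
  grading : HilbertGrading H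
  π : G →* (H ≃ₗᵢ[ℂ] H)
  continuous_π : ∀ v, Continuous (fun g => π g v)
  dense : Dense (regVectors r 𝔤₀ π : Set H)
  π_mem : ∀ g i, ∀ v ∈ grading.part i, π g v ∈ grading.part i
  ρ : (𝔤₀ × 𝔤₁) →ₗ[ℝ] Module.End ℂ (regVectors r 𝔤₀ π)
  ρ_mem : ∀ i j, ∀ x ∈ homog 𝔤₀ 𝔤₁ i, ∀ v : regVectors r 𝔤₀ π, (v : H) ∈ grading.part j →
    (ρ x v : H) ∈ grading.part (i + j)
  ρ_br : P.L.IsBracketHom ρ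
  /-- For even `x`, `ρ(x)` is the restriction of the infinitesimal generator of `π(e^(t x))`. -/
  ρ_even : ∀ (x : 𝔤₀) (v : regVectors r 𝔤₀ π),
    HasDerivAt (fun t : ℝ => π (P.exp (t • x)) (v : H)) (ρ (x, 0) v : H) 0
  /-- For odd `x`, the operator `e^(-πi/4) ρ(x)` is symmetric. -/
  ρ_odd : ∀ (x : 𝔤₁) (v w : regVectors r 𝔤₀ π),
    inner ℂ (Complex.exp (-(Real.pi * Complex.I / 4)) • (ρ (0, x) v : H)) (w : H) =
      inner ℂ (v : H) (Complex.exp (-(Real.pi * Complex.I / 4)) • (ρ (0, x) w : H))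
  /-- Every coset of the identity component contains some `g` with
  `π(g) ρ(x) π(g)⁻¹ = ρ(Ad(g) x)` for all odd `x`; here `v' = π(g) v`. -/
  ρ_component : ∀ h : G, ∃ g : G, h⁻¹ * g ∈ connectedComponent (1 : G) ∧
    ∀ (x : 𝔤₁) (v v' : regVectors r 𝔤₀ π), (v' : H) = π g v →
      π g (ρ (0, x) v : H) = (ρ (P.Ad g (0, x)) v' : H)

namespace UnitaryRep

variable {r : Regularity} {P : HarishChandraPair G 𝔤₀ 𝔤₁}
  {H : Type*} [NormedAddCommGroup H] [InnerProductSpace ℂ H] (R : UnitaryRep r P H)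

/-- The space `H^∞` (`H^ω`) of smooth (analytic) vectors. -/
abbrev vectors : Submodule ℂ H := regVectors r 𝔤₀ R.π

/-- The extension of `ρ` to `U(𝔤_ℂ)`. -/
noncomputable def ρU : P.L.Env →ₐ[ℂ] Module.End ℂ R.vectors := P.L.envLift R.ρ R.ρ_br

/-- The matrix coefficient `(g, D) ↦ ⟨π(g) ρ(D) v, w⟩`, the scalar product being linear in its first
argument (so that its arguments are exchanged in Mathlib's notation). -/
noncomputable def matrixCoeff (v w : R.vectors) : G × P.L.Env → ℂ :=
  fun s => inner ℂ (w : H) (R.π s.1 (R.ρU s.2 v : H))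

end UnitaryRep

end Representations

end SuperRep

/-! Since `π(g)` is unitary, `⟨π(g)ρ(x₁)⋯ρ(x_n)v, w⟩ = ⟨ρ(x₁)⋯ρ(x_n)v, π(g⁻¹)w⟩`, which separates
the variables: `g` enters through an orbit map composed with inversion, and the `x_k` through an
`n`-linear map into `H`. It therefore suffices that this `n`-linear map be norm continuous
(`continuous_monomial`).

For `n = 1`, even `x` give the tangent map of a `C¹` orbit map. Odd `x` are controlled by even
elements, since `ρ(x)² = ½ρ([x,x])` and symmetry up to a phase yield `‖ρ(x)v‖² ≤ ‖v‖ ‖ρ([x,x])v‖`.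
For larger `n` the unbounded operators `ρ(x_k)` cannot simply be composed. They have formal adjoints
on the dense space of smooth (analytic) vectors, so `y ↦ ρ(x₁)⋯ρ(x_n)ρ(y)v` is weakly continuous.
Barrelledness of `𝔤` turns this into norm continuity, and uniform boundedness along convergent
sequences turns separate continuity into joint continuity.

The rest is calculus. Smoothness is rephrased by iterated tangent maps (`CkOn`), for which the chain
rule is an induction. An analytic map from a Baire space to a normed space locally factors through a
continuous linear map to a normed space (`AnalyticOn.factorsAnalyticAt`): Baire bounds the series on
some ball, and polarization moves the bound to a ball around `0`. Composition then reduces to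
analytic maps between normed spaces. -/

namespace SuperRep

universe u v

/-! ## Directional derivatives and `C^k` maps -/

section DirDeriv

variable {E F : Type*}
  [AddCommGroup E] [Module ℝ E] [AddCommGroup F] [Module ℝ F] [TopologicalSpace F]

/-- `z` is the derivative of `f` at `p` in the direction `v`. -/
def HasDirDeriv (f : E → F) (p v : E) (z : F) : Prop :=
  Tendsto (fun t : ℝ => t⁻¹ • (f (p + t • v) - f p)) (𝓝[≠] 0) (𝓝 z)

/-- The tangent map `(p, v) ↦ d_v f(p)` (with a junk value where the limit does not exist). -/
noncomputable def dirDeriv (f : E → F) (q : E × E) : F :=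
  limUnder (𝓝[≠] (0 : ℝ)) (fun t : ℝ => t⁻¹ • (f (q.1 + t • q.2) - f q.1))

theorem HasDirDeriv.dirDeriv_eq [T2Space F] {f : E → F} {p v : E} {z : F}
    (h : HasDirDeriv f p v z) : dirDeriv f (p, v) = z :=
  Tendsto.limUnder_eq h

theorem HasDirDeriv.hasDirDeriv_dirDeriv [T2Space F] {f : E → F} {p v : E} {z : F}
    (h : HasDirDeriv f p v z) : HasDirDeriv f p v (dirDeriv f (p, v)) := by
  rwa [h.dirDeriv_eq]

theorem HasDirDeriv.smul [ContinuousConstSMul ℝ F] [T2Space F] {f : E → F} {p v : E} {z : F}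
    (h : HasDirDeriv f p v z) (c : ℝ) : HasDirDeriv f p (c • v) (c • z) := by
  rcases eq_or_ne c 0 with rfl | hc
  · simp [HasDirDeriv]
  · have h1 : Tendsto (fun t : ℝ => t * c) (𝓝[≠] 0) (𝓝[≠] 0) := by
      refine tendsto_nhdsWithin_iff.2 ⟨?_, ?_⟩
      · have : Tendsto (fun t : ℝ => t * c) (𝓝 0) (𝓝 (0 * c)) :=
          (continuous_id.mul continuous_const).tendsto 0
        rw [zero_mul] at this
        exact this.mono_left nhdsWithin_le_nhds
      · filter_upwards [self_mem_nhdsWithin] with t ht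
        exact mul_ne_zero ht hc
    refine ((h.comp h1).const_smul c).congr fun t => ?_
    simp only [Function.comp, smul_smul, mul_inv]
    congr 1
    rw [mul_comm t⁻¹, ← mul_assoc, mul_inv_cancel₀ hc, one_mul]

theorem hasDirDeriv_iff_hasDerivAt {F : Type*} [NormedAddCommGroup F] [NormedSpace ℝ F]
    {f : E → F} {p v : E} {z : F} :
    HasDirDeriv f p v z ↔ HasDerivAt (fun t : ℝ => f (p + t • v)) z 0 := by
  rw [hasDerivAt_iff_tendsto_slope_zero]
  simp [HasDirDeriv]

theorem HasDirDeriv.hasDerivAt_comp {F : Type*} [NormedAddCommGroup F] [NormedSpace ℝ F]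
    {f : E → F} {p v : E} {s : ℝ} {z : F} (h : HasDirDeriv f (p + s • v) v z) :
    HasDerivAt (fun t : ℝ => f (p + t • v)) z s := by
  rw [hasDerivAt_iff_tendsto_slope_zero]
  refine Tendsto.congr (fun t => ?_) h
  rw [add_smul, add_assoc]

theorem HasDirDeriv.clm_comp {F' : Type*} [AddCommGroup F'] [Module ℝ F'] [TopologicalSpace F']
    {f : E → F} {p v : E} {z : F} (h : HasDirDeriv f p v z) (l : F →L[ℝ] F') :
    HasDirDeriv (fun x => l (f x)) p v (l z) := by
  refine ((l.continuous.tendsto z).comp h).congr fun t => ?_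
  simp

theorem hasDirDeriv_congr [TopologicalSpace E] [ContinuousAdd E] [ContinuousSMul ℝ E]
    {f g : E → F} {p v : E} {z : F} {U : Set E} (hU : IsOpen U) (hp : p ∈ U)
    (hfg : EqOn f g U) (h : HasDirDeriv f p v z) : HasDirDeriv g p v z := by
  refine Tendsto.congr' ?_ h
  have h0 : Tendsto (fun t : ℝ => p + t • v) (𝓝[≠] 0) (𝓝 p) := by
    have : Tendsto (fun t : ℝ => p + t • v) (𝓝 0) (𝓝 (p + (0 : ℝ) • v)) :=
      Continuous.tendsto (by fun_prop) 0
    rw [zero_smul, add_zero] at this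
    exact this.mono_left nhdsWithin_le_nhds
  filter_upwards [h0 (hU.mem_nhds hp)] with t ht
  rw [hfg hp, hfg ht]

end DirDeriv

/-! ### Difference quotients with moving base point and direction -/

section Hadamard

variable {E F : Type*} [AddCommGroup E] [Module ℝ E] [TopologicalSpace E]
  [IsTopologicalAddGroup E] [ContinuousSMul ℝ E]

/-- A continuously differentiable map may be differentiated along difference quotients with
varying base point and direction. -/
theorem tendsto_slope_of_continuousOn [NormedAddCommGroup F] [NormedSpace ℝ F] {f : E → F}
    {df : E × E → F} {U : Set E} (hU : IsOpen U)
    (hd : ∀ p ∈ U, ∀ v, HasDirDeriv f p v (df (p, v))) (hc : ContinuousOn df (U ×ˢ univ))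
    {q w : E} (hq : q ∈ U) {Q W : ℝ → E} (hQ : Tendsto Q (𝓝[≠] 0) (𝓝 q))
    (hW : Tendsto W (𝓝[≠] 0) (𝓝 w)) :
    Tendsto (fun t : ℝ => t⁻¹ • (f (Q t + t • W t) - f (Q t))) (𝓝[≠] 0) (𝓝 (df (q, w))) := by
  rw [Metric.tendsto_nhds]
  intro ε hε
  have hcat : ContinuousAt df (q, w) :=
    hc.continuousAt ((hU.prod isOpen_univ).mem_nhds ⟨hq, mem_univ _⟩)
  have h1 : ∀ᶠ z : E × E in 𝓝 (q, w), z.1 ∈ U ∧ dist (df z) (df (q, w)) < ε / 2 :=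
    ((continuous_fst.tendsto (q, w)).eventually (hU.mem_nhds hq)).and
      (hcat.eventually (Metric.ball_mem_nhds _ (half_pos hε)))
  have hcont : Continuous fun z : ℝ × (E × E) => (z.2.1 + z.1 • z.2.2, z.2.2) := by fun_prop
  have h2 : ∀ᶠ z : ℝ × (E × E) in 𝓝 (0, (q, w)), z.2.1 + z.1 • z.2.2 ∈ U ∧
      dist (df (z.2.1 + z.1 • z.2.2, z.2.2)) (df (q, w)) < ε / 2 := by
    have := hcont.tendsto (0, (q, w))
    simp only [zero_smul, add_zero] at this
    exact this.eventually h1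
  rw [nhds_prod_eq, Filter.eventually_prod_iff] at h2
  obtain ⟨A, hA, B, hB, hAB⟩ := h2
  obtain ⟨δ, hδ, hδA⟩ := Metric.eventually_nhds_iff.1 hA
  have h3 : ∀ᶠ t : ℝ in 𝓝[≠] 0, |t| < δ := by
    have : ∀ᶠ t : ℝ in 𝓝 0, |t| < δ := by
      filter_upwards [Metric.ball_mem_nhds (0 : ℝ) hδ] with t ht
      simpa using ht
    exact this.filter_mono nhdsWithin_le_nhds
  have hQW : ∀ᶠ t : ℝ in 𝓝[≠] 0, B (Q t, W t) := (hQ.prodMk_nhds hW).eventually hB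
  filter_upwards [h3, hQW, self_mem_nhdsWithin] with t ht hBt ht0
  have ht0 : t ≠ 0 := ht0
  have key : ∀ s ∈ Icc (0 : ℝ) 1, Q t + s • (t • W t) ∈ U ∧
      dist (df (Q t + s • (t • W t), W t)) (df (q, w)) < ε / 2 := by
    intro s hs
    have : A (s * t) := hδA (by
      rw [dist_zero_right, Real.norm_eq_abs, abs_mul, abs_of_nonneg hs.1]
      exact lt_of_le_of_lt (mul_le_of_le_one_left (abs_nonneg _) hs.2) ht)
    simpa [smul_smul] using hAB this hBt
  -- Mean value inequality on the segment from `Q t` to `Q t + t • W t`, after subtracting the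
  -- expected linear term: the derivative in `s` is then at most `|t| * (ε / 2)`.
  have hder : ∀ s ∈ Icc (0 : ℝ) 1,
      HasDerivWithinAt (fun s : ℝ => f (Q t + s • (t • W t)) - s • (t • df (q, w)))
        (t • df (Q t + s • (t • W t), W t) - t • df (q, w)) (Icc 0 1) s := by
    intro s hs
    have e1 := ((hd _ (key s hs).1 (W t)).smul t).hasDerivAt_comp
    have e2 : HasDerivAt (fun s : ℝ => s • (t • df (q, w))) (t • df (q, w)) s := by
      simpa using (hasDerivAt_id s).smul_const (t • df (q, w))
    exact (e1.sub e2).hasDerivWithinAt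
  have hb := norm_image_sub_le_of_norm_deriv_le_segment_01' (C := |t| * (ε / 2)) hder (by
    intro s hs
    rw [← smul_sub, norm_smul, Real.norm_eq_abs, ← dist_eq_norm]
    exact mul_le_mul_of_nonneg_left (key s ⟨hs.1, hs.2.le⟩).2.le (abs_nonneg _))
  simp only [one_smul, zero_smul, add_zero, sub_zero] at hb
  rw [dist_eq_norm]
  have e : t⁻¹ • (f (Q t + t • W t) - f (Q t)) - df (q, w) =
      t⁻¹ • (f (Q t + t • W t) - t • df (q, w) - f (Q t)) := by
    rw [sub_right_comm, smul_sub _ _ (t • df (q, w)), smul_smul, inv_mul_cancel₀ ht0, one_smul]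
  rw [e, norm_smul, norm_inv, Real.norm_eq_abs]
  have : |t|⁻¹ * ‖f (Q t + t • W t) - t • df (q, w) - f (Q t)‖ ≤ |t|⁻¹ * (|t| * (ε / 2)) :=
    mul_le_mul_of_nonneg_left hb (by positivity)
  rw [← mul_assoc, inv_mul_cancel₀ (abs_ne_zero.2 ht0), one_mul] at this
  linarith

variable [AddCommGroup F] [Module ℝ F] [TopologicalSpace F]

/-- The increment from `p` to `p + t(a + b)` splits at `p + ta`. The second piece has direction `b`
and a moving base point, so its quotient converges by `tendsto_slope_of_continuousOn`. That result
needs normed values, hence the reduction to continuous functionals. -/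
theorem dirDeriv_add_right [SeparatingDual ℝ F] {f : E → F}
    {df : E × E → F} {U : Set E} (hU : IsOpen U)
    (hd : ∀ p ∈ U, ∀ v, HasDirDeriv f p v (df (p, v))) (hc : ContinuousOn df (U ×ˢ univ))
    {p : E} (hp : p ∈ U) (a b : E) : df (p, a + b) = df (p, a) + df (p, b) := by
  by_contra hne
  obtain ⟨l, hl⟩ := SeparatingDual.exists_ne_zero (R := ℝ) (sub_ne_zero.2 hne)
  apply hl
  have hd' : ∀ q ∈ U, ∀ v, HasDirDeriv (fun x => l (f x)) q v (l (df (q, v))) :=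
    fun q hq v => (hd q hq v).clm_comp l
  have hc' : ContinuousOn (fun q => l (df q)) (U ×ˢ univ) := l.continuous.comp_continuousOn hc
  have hQ : Tendsto (fun t : ℝ => p + t • a) (𝓝[≠] 0) (𝓝 p) := by
    have : Tendsto (fun t : ℝ => p + t • a) (𝓝 0) (𝓝 (p + (0 : ℝ) • a)) :=
      Continuous.tendsto (by fun_prop) 0
    rw [zero_smul, add_zero] at this
    exact this.mono_left nhdsWithin_le_nhds
  have h1 := tendsto_slope_of_continuousOn hU hd' hc' hp hQ (tendsto_const_nhds (x := b))
  have h2 := hd' p hp a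
  have h3 := hd' p hp (a + b)
  have h4 := tendsto_nhds_unique h3 (Tendsto.congr (fun t => by
    rw [← smul_add, smul_add t a b, ← add_assoc, sub_add_sub_cancel']) (h2.add h1))
  rw [map_sub, map_add, h4, sub_self]

end Hadamard

/-- `f` is `C^k` on `U`, in terms of iterated tangent maps. -/
def CkOn {F : Type v} [AddCommGroup F] [Module ℝ F] [TopologicalSpace F] :
    ℕ → ∀ {E : Type u} [AddCommGroup E] [Module ℝ E] [TopologicalSpace E], (E → F) → Set E → Prop
  | 0, _, _, _, _, f, U => ContinuousOn f U
  | k + 1, _, _, _, _, f, U => ContinuousOn f U ∧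
      (∀ p ∈ U, ∀ v, HasDirDeriv f p v (dirDeriv f (p, v))) ∧ CkOn k (dirDeriv f) (U ×ˢ univ)

/-! ### Permanence properties of `C^k` maps, up to the chain rule -/

namespace CkOn

variable {F : Type v} [AddCommGroup F] [Module ℝ F] [TopologicalSpace F]
  {E : Type u} [AddCommGroup E] [Module ℝ E] [TopologicalSpace E]

theorem continuousOn {k : ℕ} {f : E → F} {U : Set E} (h : CkOn k f U) : ContinuousOn f U := by
  cases k with
  | zero => exact h
  | succ k => exact h.1

theorem of_succ {k : ℕ} {E : Type u} [AddCommGroup E] [Module ℝ E] [TopologicalSpace E]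
    {f : E → F} {U : Set E} (h : CkOn (k + 1) f U) : CkOn k f U := by
  induction k generalizing E with
  | zero => exact h.1
  | succ k ih => exact ⟨h.1, h.2.1, ih h.2.2⟩

theorem mono {k : ℕ} {E : Type u} [AddCommGroup E] [Module ℝ E] [TopologicalSpace E]
    {f : E → F} {U V : Set E} (h : CkOn k f U) (hV : V ⊆ U) : CkOn k f V := by
  induction k generalizing E with
  | zero => exact ContinuousOn.mono h hV
  | succ k ih =>
    exact ⟨h.1.mono hV, fun p hp => h.2.1 p (hV hp), ih h.2.2 (prod_mono hV subset_rfl)⟩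

theorem of_locally {k : ℕ} {E : Type u} [AddCommGroup E] [Module ℝ E] [TopologicalSpace E]
    {f : E → F} {U : Set E} (h : ∀ p ∈ U, ∃ V, IsOpen V ∧ p ∈ V ∧ CkOn k f V) : CkOn k f U := by
  induction k generalizing E with
  | zero =>
    intro p hp
    obtain ⟨V, hV, hpV, hf⟩ := h p hp
    exact (hf.continuousAt (hV.mem_nhds hpV)).continuousWithinAt
  | succ k ih =>
    refine ⟨fun p hp => ?_, fun p hp => ?_, ih fun p hp => ?_⟩
    · obtain ⟨V, hV, hpV, hf⟩ := h p hp
      exact (hf.1.continuousAt (hV.mem_nhds hpV)).continuousWithinAt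
    · obtain ⟨V, hV, hpV, hf⟩ := h p hp
      exact hf.2.1 p hpV
    · obtain ⟨V, hV, hpV, hf⟩ := h p.1 hp.1
      exact ⟨V ×ˢ univ, hV.prod isOpen_univ, ⟨hpV, mem_univ _⟩, hf.2.2⟩

theorem congr [T2Space F] {k : ℕ} {E : Type u} [AddCommGroup E] [Module ℝ E] [TopologicalSpace E]
    [ContinuousAdd E] [ContinuousSMul ℝ E]
    {f g : E → F} {U : Set E} (hU : IsOpen U) (hfg : EqOn f g U) (h : CkOn k f U) :
    CkOn k g U := by
  induction k generalizing E with
  | zero => exact ContinuousOn.congr h fun p hp => (hfg hp).symm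
  | succ k ih =>
    have hd : ∀ p ∈ U, ∀ v, HasDirDeriv g p v (dirDeriv f (p, v)) := fun p hp v =>
      hasDirDeriv_congr hU hp hfg (h.2.1 p hp v)
    exact ⟨h.1.congr fun p hp => (hfg hp).symm, fun p hp v => (hd p hp v).hasDirDeriv_dirDeriv,
      ih (hU.prod isOpen_univ) (fun q hq => ((hd q.1 hq.1 q.2).dirDeriv_eq).symm) h.2.2⟩

/-- To check that `f` is `C^(k+1)`, one may use any function that is the tangent map on `U`. -/
theorem succ_of_hasDirDeriv [T2Space F] [ContinuousAdd E] [ContinuousSMul ℝ E] {k : ℕ} {f : E → F}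
    {df : E × E → F} {U : Set E} (hU : IsOpen U) (hf : ContinuousOn f U)
    (hd : ∀ p ∈ U, ∀ v, HasDirDeriv f p v (df (p, v))) (h : CkOn k df (U ×ˢ univ)) :
    CkOn (k + 1) f U :=
  ⟨hf, fun p hp v => (hd p hp v).hasDirDeriv_dirDeriv,
    h.congr (hU.prod isOpen_univ) fun q hq => ((hd q.1 hq.1 q.2).dirDeriv_eq).symm⟩

/-- The difference quotients of `f ∘ A` are literally those of `f`, so the formula for `dirDeriv`
holds even for junk values. Hence neither openness of `U` nor separation of `F` is required. -/
theorem comp_linear {k : ℕ} {E : Type u} [AddCommGroup E] [Module ℝ E] [TopologicalSpace E]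
    {E' : Type*} [AddCommGroup E'] [Module ℝ E'] [TopologicalSpace E']
    {f : E → F} {U : Set E} {A : E' → E} (hA : Continuous A)
    (hA' : ∀ x v, ∀ t : ℝ, A (x + t • v) = A x + t • A v) (h : CkOn k f U) :
    CkOn k (fun x => f (A x)) (A ⁻¹' U) := by
  induction k generalizing E E' with
  | zero => exact ContinuousOn.comp h hA.continuousOn fun x hx => hx
  | succ k ih =>
    have e : dirDeriv (fun x => f (A x)) = fun q : E' × E' => dirDeriv f (A q.1, A q.2) := by
      funext q
      simp only [dirDeriv, hA']
    refine ⟨h.1.comp hA.continuousOn fun x hx => hx, fun p hp v => ?_, ?_⟩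
    · rw [e]
      simpa only [HasDirDeriv, hA'] using h.2.1 (A p) hp (A v)
    · rw [e]
      refine (ih (A := fun q : E' × E' => (A q.1, A q.2)) (by fun_prop) ?_ h.2.2).mono ?_
      · intro x v t
        simp [hA']
      · rintro q ⟨hq, -⟩
        exact ⟨hq, mem_univ _⟩

theorem comp_add_const {k : ℕ} {E : Type u} [AddCommGroup E] [Module ℝ E] [TopologicalSpace E]
    [ContinuousAdd E]
    {f : E → F} {U : Set E} (b : E) (h : CkOn k f U) :
    CkOn k (fun x => f (x + b)) ((· + b) ⁻¹' U) := by
  induction k generalizing E with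
  | zero => exact ContinuousOn.comp h (by fun_prop) fun x hx => hx
  | succ k ih =>
    have e : dirDeriv (fun x => f (x + b)) = fun q : E × E => dirDeriv f (q + (b, 0)) := by
      funext q
      simp [dirDeriv, add_right_comm]
    refine ⟨h.1.comp (by fun_prop) fun x hx => hx, fun p hp v => ?_, ?_⟩
    · rw [e]
      simpa [HasDirDeriv, add_right_comm] using h.2.1 (p + b) hp v
    · rw [e]
      refine (ih (b, 0) h.2.2).mono ?_
      rintro q ⟨hq, -⟩
      exact ⟨hq, mem_univ _⟩

variable [ContinuousAdd E] [ContinuousSMul ℝ E]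

theorem prodMk [T2Space F] {F' : Type*} [AddCommGroup F'] [Module ℝ F'] [TopologicalSpace F']
    [T2Space F'] {k : ℕ} {E : Type u} [AddCommGroup E] [Module ℝ E] [TopologicalSpace E]
    [ContinuousAdd E] [ContinuousSMul ℝ E] {f : E → F} {g : E → F'} {U : Set E} (hU : IsOpen U)
    (hf : CkOn k f U) (hg : CkOn k g U) : CkOn k (fun x => (f x, g x)) U := by
  induction k generalizing E with
  | zero => exact ContinuousOn.prodMk hf hg
  | succ k ih =>
    refine succ_of_hasDirDeriv (df := fun q => (dirDeriv f q, dirDeriv g q)) hU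
      (hf.1.prodMk hg.1) (fun p hp v => ?_) (ih (hU.prod isOpen_univ) hf.2.2 hg.2.2)
    exact (hf.2.1 p hp v).prodMk_nhds (hg.2.1 p hp v)

theorem add [T2Space F] [ContinuousAdd F] {k : ℕ} {E : Type u} [AddCommGroup E] [Module ℝ E]
    [TopologicalSpace E] [ContinuousAdd E] [ContinuousSMul ℝ E] {f g : E → F} {U : Set E}
    (hU : IsOpen U) (hf : CkOn k f U) (hg : CkOn k g U) : CkOn k (fun x => f x + g x) U := by
  induction k generalizing E with
  | zero => exact ContinuousOn.add hf hg
  | succ k ih =>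
    refine succ_of_hasDirDeriv (df := fun q => dirDeriv f q + dirDeriv g q) hU
      (hf.1.add hg.1) (fun p hp v => ?_) (ih (hU.prod isOpen_univ) hf.2.2 hg.2.2)
    refine ((hf.2.1 p hp v).add (hg.2.1 p hp v)).congr fun t => ?_
    rw [← smul_add, sub_add_sub_comm]

theorem const_smul [T2Space F] [ContinuousConstSMul ℝ F] {k : ℕ} {E : Type u} [AddCommGroup E]
    [Module ℝ E] [TopologicalSpace E] [ContinuousAdd E] [ContinuousSMul ℝ E] {f : E → F}
    {U : Set E} (hU : IsOpen U) (hf : CkOn k f U) (c : ℝ) : CkOn k (fun x => c • f x) U := by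
  induction k generalizing E with
  | zero => exact ContinuousOn.const_smul hf c
  | succ k ih =>
    refine succ_of_hasDirDeriv (df := fun q => c • dirDeriv f q) hU
      (hf.1.const_smul c) (fun p hp v => ?_) (ih (hU.prod isOpen_univ) hf.2.2)
    refine ((hf.2.1 p hp v).const_smul c).congr fun t => ?_
    rw [← smul_sub, smul_comm]

theorem sum [T2Space F] [ContinuousAdd F] [ContinuousConstSMul ℝ F] {k : ℕ} {κ : Type*}
    {f : κ → E → F} {U : Set E} (hU : IsOpen U) {s : Finset κ} (hs : s.Nonempty)
    (h : ∀ i ∈ s, CkOn k (f i) U) :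
    CkOn k (fun x => ∑ i ∈ s, f i x) U := by
  classical
  induction hs using Finset.Nonempty.cons_induction with
  | singleton a => simpa using h a (by simp)
  | cons a s ha hs ih =>
    simp only [Finset.sum_cons]
    exact (h a (by simp)).add hU (ih fun i hi => h i (by simp [hi]))

/-- The chain rule, for outer maps with values in a normed space. -/
theorem comp {F : Type v} [NormedAddCommGroup F] [NormedSpace ℝ F] {k : ℕ}
    {E : Type u} [AddCommGroup E] [Module ℝ E] [TopologicalSpace E]
    [IsTopologicalAddGroup E] [ContinuousSMul ℝ E] [T2Space E]
    {E' : Type*} [AddCommGroup E'] [Module ℝ E'] [TopologicalSpace E']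
    [ContinuousAdd E'] [ContinuousSMul ℝ E']
    {f : E → F} {h : E' → E} {U : Set E} {V : Set E'} (hU : IsOpen U) (hV : IsOpen V)
    (hf : CkOn k f U) (hh : CkOn k h V) (hVU : MapsTo h V U) : CkOn k (fun x => f (h x)) V := by
  induction k generalizing E E' with
  | zero => exact ContinuousOn.comp hf hh hVU
  | succ k ih =>
    refine succ_of_hasDirDeriv (df := fun q => dirDeriv f (h q.1, dirDeriv h q)) hV
      (hf.1.comp hh.1 hVU) (fun p hp v => ?_)
      (ih (h := fun q : E' × E' => (h q.1, dirDeriv h q)) (hU.prod isOpen_univ)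
        (hV.prod isOpen_univ) hf.2.2 ?_ fun q hq => ⟨hVU hq.1, mem_univ _⟩)
    -- Here `h (p + t • v) = h p + t • W t`, with `W t` the difference quotient of `h`: fixed base
    -- point, varying direction.
    · have := tendsto_slope_of_continuousOn hU hf.2.1 hf.2.2.continuousOn (hVU hp)
        tendsto_const_nhds (hh.2.1 p hp v)
      refine Tendsto.congr' ?_ this
      filter_upwards [self_mem_nhdsWithin] with t ht
      have ht : t ≠ 0 := ht
      rw [smul_smul, mul_inv_cancel₀ ht, one_smul, add_sub_cancel]
    · refine prodMk (hV.prod isOpen_univ) ?_ hh.2.2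
      exact (comp_linear (A := Prod.fst) continuous_fst (by simp) hh.of_succ).mono
        fun q hq => hq.1

theorem of_contDiffOn {F : Type v} [NormedAddCommGroup F] [NormedSpace ℝ F]
    {E : Type u} [NormedAddCommGroup E] [NormedSpace ℝ E] {f : E → F} {U : Set E} (hU : IsOpen U)
    {k : ℕ} (hf : ContDiffOn ℝ k f U) : CkOn k f U := by
  induction k generalizing E with
  | zero => exact hf.continuousOn
  | succ k ih =>
    have h1 : ContDiffOn ℝ k (fderiv ℝ f) U :=
      hf.fderiv_of_isOpen hU (by push_cast; exact le_rfl)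
    refine succ_of_hasDirDeriv (df := fun q => fderiv ℝ f q.1 q.2) hU hf.continuousOn
      (fun p hp v => ?_) (ih (hU.prod isOpen_univ) ?_)
    · rw [hasDirDeriv_iff_hasDerivAt]
      have hd : DifferentiableAt ℝ f (p + (0 : ℝ) • v) := by
        simpa using (hf.differentiableOn (by simp)).differentiableAt (hU.mem_nhds hp)
      have hl : HasDerivAt (fun t : ℝ => p + t • v) v 0 := by
        simpa using ((hasDerivAt_id (0 : ℝ)).smul_const v).const_add p
      simpa [Function.comp_def] using hd.hasFDerivAt.comp_hasDerivAt (0 : ℝ) hl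
    · exact (h1.comp contDiffOn_fst fun q hq => hq.1).clm_apply contDiffOn_snd

end CkOn

/-! ## Comparison with `SmoothOn` -/

section SmoothOn

variable {F : Type v} [AddCommGroup F] [Module ℝ F] [TopologicalSpace F]
  {E : Type u} [AddCommGroup E] [Module ℝ E] [TopologicalSpace E]

/-- The iterated directional derivative `d^j f(p)(v₁, …, v_j)`. -/
noncomputable def iterDirDeriv (f : E → F) : (j : ℕ) → E × (Fin j → E) → F
  | 0, q => f q.1
  -- The direction `(v_last, 0)` moves the base point only and keeps the earlier directions fixed.
  | j + 1, q => dirDeriv (iterDirDeriv f j) ((q.1, Fin.init q.2), (q.2 (Fin.last j), 0))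

theorem continuous_finInit {X : Type*} [TopologicalSpace X] {j : ℕ} :
    Continuous fun v : Fin (j + 1) → X => (Fin.init v : Fin j → X) :=
  continuous_pi fun _ => continuous_apply _

/-- Each iterate is a tangent map precomposed with a continuous linear map. It costs one degree of
differentiability, so all `k` have to be available at once. -/
theorem CkOn.iterDirDeriv {f : E → F} {U : Set E} (hf : ∀ k, CkOn k f U) (j k : ℕ) :
    CkOn k (iterDirDeriv f j) (U ×ˢ univ) := by
  induction j generalizing k with
  | zero =>
    exact (comp_linear (A := Prod.fst) continuous_fst (by simp) (hf k)).mono fun q hq => hq.1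
  | succ j ih =>
    refine (comp_linear (A := fun q : E × (Fin (j + 1) → E) =>
      (((q.1, Fin.init q.2), (q.2 (Fin.last j), 0)) : (E × (Fin j → E)) × (E × (Fin j → E))))
      ?_ ?_ (ih (k + 1)).2.2).mono ?_
    · have := continuous_finInit (X := E) (j := j)
      fun_prop
    · intro x v t
      ext <;> simp [Fin.init]
    · intro q hq
      exact ⟨⟨hq.1, mem_univ _⟩, mem_univ _⟩

theorem smoothOn_of_forall_ckOn {f : E → F} {U : Set E} (hf : ∀ k, CkOn k f U) : SmoothOn f U := by
  refine ⟨fun j p v => iterDirDeriv f j (p, v), fun p _ v => rfl, fun j p hp v => ?_,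
    fun j => (CkOn.iterDirDeriv hf j 0).continuousOn⟩
  have := (CkOn.iterDirDeriv hf j 1).2.1 (p, Fin.init v) ⟨hp, mem_univ _⟩ (v (Fin.last j), 0)
  simpa [HasDirDeriv, iterDirDeriv] using this

/-- The derivatives witnessing smoothness are multilinear in the directions. -/
theorem exists_multilinearMap_of_smooth [IsTopologicalAddGroup F] [ContinuousSMul ℝ F]
    [SeparatingDual ℝ F] [T2Space F] [IsTopologicalAddGroup E] [ContinuousSMul ℝ E]
    {U : Set E} (hU : IsOpen U) {D : (j : ℕ) → E → (Fin j → E) → F}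
    (hD : ∀ j, ∀ p ∈ U, ∀ v : Fin (j + 1) → E,
      HasDirDeriv (fun x => D j x (Fin.init v)) p (v (Fin.last j)) (D (j + 1) p v))
    (hc : ∀ j, ContinuousOn (fun q : E × (Fin j → E) => D j q.1 q.2) (U ×ˢ univ))
    (j : ℕ) {p : E} (hp : p ∈ U) : ∃ m : MultilinearMap ℝ (fun _ : Fin j => E) F, ⇑m = D j p := by
  induction j generalizing p with
  | zero =>
    exact ⟨MultilinearMap.constOfIsEmpty ℝ _ (D 0 p 0), by
      ext v
      simp [Subsingleton.elim v 0]⟩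
  | succ j ih =>
    have hev : ∀ w : E, ∀ᶠ t : ℝ in 𝓝[≠] 0, p + t • w ∈ U := by
      intro w
      have : Tendsto (fun t : ℝ => p + t • w) (𝓝 0) (𝓝 (p + (0 : ℝ) • w)) :=
        Continuous.tendsto (by fun_prop) 0
      rw [zero_smul, add_zero] at this
      exact (this.mono_left nhdsWithin_le_nhds) (hU.mem_nhds hp)
    refine ⟨MultilinearMap.mk' (D (j + 1) p) (fun v i a b => ?_) (fun v i c a => ?_), rfl⟩
    -- In the last, newly added direction, additivity comes from `dirDeriv_add_right`. In the
    -- earlier ones it passes to the limit from multilinearity at `p` and at `p + t • v_last`.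
    · induction i using Fin.lastCases with
      | last =>
        have := dirDeriv_add_right (f := fun x => D j x (Fin.init v))
          (df := fun q => D (j + 1) q.1 (Function.update v (Fin.last j) q.2)) hU
          (fun q hq w => by
            simpa [Fin.init_update_last] using hD j q hq (Function.update v (Fin.last j) w))
          ((hc (j + 1)).comp (f := fun q : E × E => (q.1, Function.update v (Fin.last j) q.2))
            (by fun_prop) fun q hq => ⟨hq.1, mem_univ _⟩) hp a b
        exact this
      | cast i =>
        have h1 := hD j p hp (Function.update v i.castSucc (a + b))
        have h2 := hD j p hp (Function.update v i.castSucc a)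
        have h3 := hD j p hp (Function.update v i.castSucc b)
        have hne : Fin.last j ≠ i.castSucc := (Fin.castSucc_lt_last i).ne'
        simp only [Fin.init_update_castSucc, Function.update_of_ne hne] at h1 h2 h3
        refine tendsto_nhds_unique h1 (Tendsto.congr' ?_ (h2.add h3))
        filter_upwards [hev (v (Fin.last j))] with t ht
        obtain ⟨m, hm⟩ := ih hp
        obtain ⟨m', hm'⟩ := ih ht
        rw [← hm, ← hm', MultilinearMap.map_update_add, MultilinearMap.map_update_add, ← smul_add,
          sub_add_sub_comm]
    · induction i using Fin.lastCases with
      | last =>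
        have h1 := hD j p hp (Function.update v (Fin.last j) (c • a))
        have h2 := hD j p hp (Function.update v (Fin.last j) a)
        simp only [Fin.init_update_last, Function.update_self] at h1 h2
        exact tendsto_nhds_unique h1 (h2.smul c)
      | cast i =>
        have h1 := hD j p hp (Function.update v i.castSucc (c • a))
        have h2 := hD j p hp (Function.update v i.castSucc a)
        have hne : Fin.last j ≠ i.castSucc := (Fin.castSucc_lt_last i).ne'
        simp only [Fin.init_update_castSucc, Function.update_of_ne hne] at h1 h2
        refine tendsto_nhds_unique h1 (Tendsto.congr' ?_ (h2.const_smul c))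
        filter_upwards [hev (v (Fin.last j))] with t ht
        obtain ⟨m, hm⟩ := ih hp
        obtain ⟨m', hm'⟩ := ih ht
        rw [← hm, ← hm', MultilinearMap.map_update_smul, MultilinearMap.map_update_smul, ← smul_sub,
          smul_comm]

/-- The derivative of `(p, v) ↦ m_p(v)`, with `m_p` multilinear, in terms of the partial
derivative in `p`. -/
theorem hasDirDeriv_multilinear [IsTopologicalAddGroup F] [ContinuousSMul ℝ F]
    [IsTopologicalAddGroup E] [ContinuousSMul ℝ E] {U : Set E} (hU : IsOpen U)
    {j : ℕ} {D : E → (Fin j → E) → F}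
    (hm : ∀ p ∈ U, ∃ m : MultilinearMap ℝ (fun _ : Fin j => E) F, ⇑m = D p)
    (hc : ContinuousOn (fun q : E × (Fin j → E) => D q.1 q.2) (U ×ˢ univ))
    {p u : E} (hp : p ∈ U) {v w : Fin j → E} {z : F} (hz : HasDirDeriv (fun x => D x v) p u z) :
    HasDirDeriv (fun q : E × (Fin j → E) => D q.1 q.2) (p, v) (u, w)
      (z + ∑ s ∈ Finset.univ.erase (Finset.univ : Finset (Fin j)),
        ((0 : ℝ) ^ (sᶜ.card - 1)) • D p (s.piecewise v w)) := by
  have hp0 : Tendsto (fun t : ℝ => p + t • u) (𝓝[≠] 0) (𝓝 p) := by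
    have : Tendsto (fun t : ℝ => p + t • u) (𝓝 0) (𝓝 (p + (0 : ℝ) • u)) :=
      Continuous.tendsto (by fun_prop) 0
    rw [zero_smul, add_zero] at this
    exact this.mono_left nhdsWithin_le_nhds
  -- Expanding `m(v + tw)` over subsets and dividing by `t` leaves `t ^ (|sᶜ| - 1)`. In the limit
  -- only the terms with a single `w` survive, because `0 ^ 0 = 1`; the term `s = univ` is the
  -- partial derivative in `p`.
  have hs : ∀ s : Finset (Fin j), Tendsto
      (fun t : ℝ => (t ^ (sᶜ.card - 1)) • D (p + t • u) (s.piecewise v w)) (𝓝[≠] 0)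
      (𝓝 (((0 : ℝ) ^ (sᶜ.card - 1)) • D p (s.piecewise v w))) := by
    intro s
    refine Tendsto.smul ?_ ?_
    · exact ((continuous_pow _).tendsto (0 : ℝ)).mono_left nhdsWithin_le_nhds
    · have hca := hc.continuousAt (x := (p, s.piecewise v w))
        ((hU.prod isOpen_univ).mem_nhds ⟨hp, mem_univ _⟩)
      exact hca.tendsto.comp (hp0.prodMk_nhds tendsto_const_nhds)
  refine Tendsto.congr' ?_ (hz.add (tendsto_finsetSum _ fun s _ => hs s))
  filter_upwards [hp0 (hU.mem_nhds hp), self_mem_nhdsWithin] with t ht ht0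
  have ht0 : t ≠ 0 := ht0
  obtain ⟨m, hm⟩ := hm _ ht
  have e1 : D (p + t • u) (v + t • w) = D (p + t • u) v +
      ∑ s ∈ Finset.univ.erase (Finset.univ : Finset (Fin j)),
        t ^ sᶜ.card • D (p + t • u) (s.piecewise v w) := by
    rw [← hm, MultilinearMap.map_add_univ,
      ← Finset.add_sum_erase _ _ (Finset.mem_univ (Finset.univ : Finset (Fin j)))]
    congr 1
    · simp
    · refine Finset.sum_congr rfl fun s _ => ?_
      have := m.map_piecewise_smul (fun _ => t) (s.piecewise v w) sᶜ
      rw [Finset.prod_const] at this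
      rw [← this]
      congr 1
      ext i
      by_cases hi : i ∈ s <;> simp [hi]
  simp only [Prod.smul_mk, Prod.mk_add_mk, e1]
  rw [add_sub_right_comm, smul_add, Finset.smul_sum]
  congr 1
  refine Finset.sum_congr rfl fun s hs' => ?_
  have hcard : sᶜ.card ≠ 0 := by
    rw [Ne, Finset.card_eq_zero, Finset.compl_eq_empty_iff]
    exact (Finset.mem_erase.1 hs').1
  obtain ⟨n, hn⟩ := Nat.exists_eq_succ_of_ne_zero hcard
  rw [hn, smul_smul, Nat.succ_sub_one, pow_succ', ← mul_assoc, inv_mul_cancel₀ ht0, one_mul]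

/-- The tangent map of `(p, v) ↦ D j p v` is built linearly from `D (j + 1)` and `D j`. The family
of all `D j` is thus stable under tangent maps, and the induction on `k` treats all `j`
simultaneously. -/
theorem SmoothOn.ckOn [IsTopologicalAddGroup F] [ContinuousSMul ℝ F]
    [SeparatingDual ℝ F] [T2Space F] [IsTopologicalAddGroup E] [ContinuousSMul ℝ E]
    {f : E → F} {U : Set E} (hU : IsOpen U) (hf : SmoothOn f U) (k : ℕ) : CkOn k f U := by
  obtain ⟨D, h0, hD, hc⟩ := hf
  have key : ∀ j, CkOn k (fun q : E × (Fin j → E) => D j q.1 q.2) (U ×ˢ univ) := by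
    induction k with
    | zero => exact hc
    | succ k ih =>
      intro j
      have hUo : IsOpen ((U ×ˢ univ : Set (E × (Fin j → E))) ×ˢ
        (univ : Set (E × (Fin j → E)))) := (hU.prod isOpen_univ).prod isOpen_univ
      refine CkOn.succ_of_hasDirDeriv (hU.prod isOpen_univ) (hc j)
        (df := fun q => D (j + 1) q.1.1 (Fin.snoc q.1.2 q.2.1) +
          ∑ s ∈ Finset.univ.erase (Finset.univ : Finset (Fin j)),
            ((0 : ℝ) ^ (sᶜ.card - 1)) • D j q.1.1 (s.piecewise q.1.2 q.2.2)) ?_ ?_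
      · rintro ⟨p, v⟩ ⟨hp, -⟩ ⟨u, w⟩
        refine hasDirDeriv_multilinear hU
          (fun p hp => exists_multilinearMap_of_smooth hU hD hc j hp) (hc j) hp ?_
        simpa [HasDirDeriv] using hD j p hp (Fin.snoc v u)
      · have hfirst : CkOn k (fun q : (E × (Fin j → E)) × (E × (Fin j → E)) =>
            D (j + 1) q.1.1 (Fin.snoc (α := fun _ => E) q.1.2 q.2.1))
            ((U ×ˢ univ) ×ˢ univ) := by
          refine (CkOn.comp_linear (A := fun q : (E × (Fin j → E)) × (E × (Fin j → E)) =>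
            (q.1.1, Fin.snoc (α := fun _ => E) q.1.2 q.2.1)) ?_ ?_ (ih (j + 1))).mono ?_
          · exact (continuous_fst.comp continuous_fst).prodMk
              (Continuous.finSnoc (continuous_snd.comp continuous_fst)
                (continuous_fst.comp continuous_snd))
          · intro x v t
            ext i
            · rfl
            · induction i using Fin.lastCases <;> simp
          · intro q hq
            exact ⟨hq.1.1, mem_univ _⟩
        -- The index set is empty exactly for `j = 0`.
        rcases (Finset.univ.erase (Finset.univ : Finset (Fin j))).eq_empty_or_nonempty with he | he
        · simpa [he] using hfirst
        · refine hfirst.add hUo (CkOn.sum hUo he fun s _ => CkOn.const_smul hUo ?_ _)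
          refine (CkOn.comp_linear (A := fun q : (E × (Fin j → E)) × (E × (Fin j → E)) =>
            (q.1.1, s.piecewise q.1.2 q.2.2)) ?_ ?_ (ih j)).mono ?_
          · refine (continuous_fst.comp continuous_fst).prodMk (continuous_pi fun i => ?_)
            by_cases hi : i ∈ s <;> simp only [hi, Finset.piecewise_eq_of_mem,
              Finset.piecewise_eq_of_notMem, not_false_eq_true] <;> fun_prop
          · intro x v t
            ext i
            · rfl
            · by_cases hi : i ∈ s <;> simp [hi]
          · intro q hq
            exact ⟨hq.1.1, mem_univ _⟩
  refine CkOn.congr hU (fun p hp => h0 p hp 0)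
    ((CkOn.comp_linear (A := fun p : E => (p, (0 : Fin 0 → E))) (by fun_prop) ?_ (key 0)).mono ?_)
  · intro x v t
    simp
  · intro p hp
    exact ⟨hp, mem_univ _⟩

end SmoothOn

/-! ## Seminorms and multilinear maps -/

section Seminorms

theorem exists_continuous_seminorm_ball_subset {E : Type*} [AddCommGroup E] [Module ℝ E]
    [TopologicalSpace E] [IsTopologicalAddGroup E] [ContinuousSMul ℝ E] [LocallyConvexSpace ℝ E]
    {W : Set E} (hW : W ∈ 𝓝 (0 : E)) :
    ∃ q : Seminorm ℝ E, Continuous q ∧ {v | q v ≤ 1} ⊆ W := by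
  have hws := PolynormableSpace.withSeminorms ℝ E
  obtain ⟨⟨s, r⟩, hr, hsub⟩ := hws.hasBasis_zero_ball.mem_iff.1 hW
  have hr : 0 < r := hr
  have hc : Continuous ⇑(s.sup (fun p : {p : Seminorm ℝ E // Continuous p} => p.1)) := by
    refine Finset.sup_induction (p := fun q : Seminorm ℝ E => Continuous q) ?_ ?_ ?_
    · exact continuous_const
    · intro p hp q hq
      exact Continuous.max hp hq
    · intro p _
      exact p.2
  -- The factor `2 / r` makes the closed unit ball the ball of radius `r / 2`, which lies inside the
  -- open ball of radius `r`.
  refine ⟨NNReal.mk (2 / r) (by positivity) • s.sup (fun p => p.1), ?_, fun v hv => hsub ?_⟩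
  · exact hc.const_smul (NNReal.mk (2 / r) (by positivity))
  · rw [Seminorm.mem_ball_zero]
    have hv : 2 / r * (s.sup (fun p : {p : Seminorm ℝ E // Continuous p} => p.1)) v ≤ 1 := hv
    rw [div_mul_eq_mul_div, div_le_one hr] at hv
    have := apply_nonneg (s.sup (fun p : {p : Seminorm ℝ E // Continuous p} => p.1)) v
    linarith

/-- The normed space associated with a seminorm, with a linear section. -/
theorem exists_normedSpace_of_seminorm {E : Type u} [AddCommGroup E] [Module ℝ E]
    (q : Seminorm ℝ E) :
    ∃ (X : Type u) (_ : NormedAddCommGroup X) (_ : NormedSpace ℝ X) (l : E →ₗ[ℝ] X)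
      (σ : X →ₗ[ℝ] E), (∀ x, l (σ x) = x) ∧ ∀ v, ‖l v‖ = q v := by
  let : SeminormedAddCommGroup E := q.toAddGroupSeminorm.toSeminormedAddCommGroup
  let : NormedSpace ℝ E := { norm_smul_le := fun a b => (map_smul_eq_mul q a b).le }
  obtain ⟨σ, hσ⟩ := SeparationQuotient.exists_out_continuousLinearMap ℝ E
  exact ⟨SeparationQuotient E, inferInstance, inferInstance,
    (SeparationQuotient.mkCLM ℝ E).toLinearMap, σ.toLinearMap,
    fun x => congrArg (fun f => f x) hσ, fun v => rfl⟩

/-- Homogeneity: rescale each `u i` into the unit ball. The `ε`, sent to `0` at the end, keeps the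
scaling factors positive when `q (u i) = 0`. -/
theorem norm_multilinearMap_le_of_ball {E F : Type*} [AddCommGroup E] [Module ℝ E]
    [NormedAddCommGroup F] [NormedSpace ℝ F] {n : ℕ} (q : Seminorm ℝ E)
    (β : MultilinearMap ℝ (fun _ : Fin n => E) F) {C : ℝ}
    (h : ∀ u : Fin n → E, (∀ i, q (u i) ≤ 1) → ‖β u‖ ≤ C) (u : Fin n → E) :
    ‖β u‖ ≤ C * ∏ i, q (u i) := by
  have key : ∀ ε : ℝ, 0 < ε → ‖β u‖ ≤ C * ∏ i, (q (u i) + ε) := by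
    intro ε hε
    have hpos : ∀ i, 0 < q (u i) + ε := fun i => add_pos_of_nonneg_of_pos (apply_nonneg q _) hε
    have e : u = fun i => (q (u i) + ε) • ((q (u i) + ε)⁻¹ • u i) := by
      funext i
      rw [smul_smul, mul_inv_cancel₀ (hpos i).ne', one_smul]
    have e2 : β u = (∏ i, (q (u i) + ε)) • β fun i => (q (u i) + ε)⁻¹ • u i := by
      conv_lhs => rw [e]
      exact β.map_smul_univ _ _
    have hP : 0 ≤ ∏ i, (q (u i) + ε) := Finset.prod_nonneg fun i _ => (hpos i).le
    rw [e2, norm_smul, Real.norm_of_nonneg hP, mul_comm]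
    refine mul_le_mul_of_nonneg_right (h _ fun i => ?_) hP
    rw [map_smul_eq_mul, norm_inv, Real.norm_of_nonneg (hpos i).le, inv_mul_le_one₀ (hpos i)]
    linarith
  have hlim : Tendsto (fun ε : ℝ => C * ∏ i, (q (u i) + ε)) (𝓝[>] 0)
      (𝓝 (C * ∏ i, (q (u i) + 0))) :=
    (Continuous.tendsto (by fun_prop) 0).mono_left nhdsWithin_le_nhds
  have := ge_of_tendsto hlim (by
    filter_upwards [self_mem_nhdsWithin] with ε hε using key ε hε)
  simpa using this

/-- A multilinear map that is bounded on the unit ball of a seminorm factors through the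
associated normed space. -/
theorem exists_continuousMultilinearMap_of_ball {E F X : Type*} [AddCommGroup E] [Module ℝ E]
    [NormedAddCommGroup F] [NormedSpace ℝ F] [NormedAddCommGroup X] [NormedSpace ℝ X] {n : ℕ}
    {q : Seminorm ℝ E} {l : E →ₗ[ℝ] X} {σ : X →ₗ[ℝ] E} (hσ : ∀ x, l (σ x) = x)
    (hl : ∀ v, ‖l v‖ = q v) (β : MultilinearMap ℝ (fun _ : Fin n => E) F) {C : ℝ} (hC : 0 ≤ C)
    (h : ∀ u : Fin n → E, (∀ i, q (u i) ≤ 1) → ‖β u‖ ≤ C) :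
    ∃ m : ContinuousMultilinearMap ℝ (fun _ : Fin n => X) F, ‖m‖ ≤ C ∧
      ∀ u, β u = m (fun i => l (u i)) := by
  have hb := norm_multilinearMap_le_of_ball q β h
  have hm : ∀ y : Fin n → X, ‖β.compLinearMap (fun _ => σ) y‖ ≤ C * ∏ i, ‖y i‖ := by
    intro y
    simpa [← hl, hσ] using hb fun i => σ (y i)
  refine ⟨(β.compLinearMap fun _ => σ).mkContinuous C hm,
    MultilinearMap.mkContinuous_norm_le _ hC hm, fun u => ?_⟩
  change β u = β fun i => σ (l (u i))
  let : SeminormedAddCommGroup E := q.toAddGroupSeminorm.toSeminormedAddCommGroup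
  let : NormedSpace ℝ E := { norm_smul_le := fun a b => (map_smul_eq_mul q a b).le }
  -- The tuples `u` and `σ ∘ l ∘ u` are at distance `0` for `q`, so the Lipschitz estimate for
  -- bounded multilinear maps forces equal values.
  have hd := β.norm_image_sub_le_of_bound hC hb u fun i => σ (l (u i))
  have h0 : ‖u - fun i => σ (l (u i))‖ = 0 := by
    refine le_antisymm ((pi_norm_le_iff_of_nonneg le_rfl).2 fun i => ?_) (norm_nonneg _)
    change q (u i - σ (l (u i))) ≤ 0
    rw [← hl, map_sub, hσ, sub_self, norm_zero]
  rw [h0, mul_zero] at hd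
  exact sub_eq_zero.1 (norm_le_zero_iff.1 hd)

end Seminorms

/-! ## Polarization -/

section Polarization

variable {E F : Type*} [AddCommGroup E] [Module ℝ E] [AddCommGroup F] [Module ℝ F] {n : ℕ}

/-- The polarization formula, for an arbitrary base point `a`. -/
theorem sum_sign_smul_diag_eq_sum_perm (β : MultilinearMap ℝ (fun _ : Fin n => E) F) (a : E)
    (u : Fin n → E) :
    ∑ s : Finset (Fin n), (∏ i, if i ∈ s then (1 : ℝ) else -1) •
      β (fun _ => a + ∑ i ∈ s, u i) = ∑ τ : Equiv.Perm (Fin n), β (fun i => u (τ i)) := by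
  -- The base point `a` is treated as an extra vector, indexed by `none`, which is present for every
  -- `s`.
  set w : Option (Fin n) → E := fun o => o.elim a u with hw
  set c : Finset (Fin n) → Option (Fin n) → ℝ := fun s o => o.elim 1 fun i => if i ∈ s then 1 else 0
    with hc
  have e1 : ∀ s : Finset (Fin n), a + ∑ i ∈ s, u i = ∑ o, c s o • w o := by
    intro s
    simp [hw, hc, Fintype.sum_option, ite_smul, Finset.sum_ite_mem]
  have e2 : ∀ s : Finset (Fin n), β (fun _ => a + ∑ i ∈ s, u i) =
      ∑ r : Fin n → Option (Fin n), (∏ k, c s (r k)) • β (fun k => w (r k)) := by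
    intro s
    rw [e1, β.map_sum (fun _ o => c s o • w o)]
    exact Finset.sum_congr rfl fun r _ => β.map_smul_univ _ _
  simp_rw [e2, Finset.smul_sum, smul_smul]
  rw [Finset.sum_comm]
  simp_rw [← Finset.sum_smul]
  symm
  refine Fintype.sum_of_injective
    (fun (τ : Equiv.Perm (Fin n)) (k : Fin n) => (some (τ k) : Option (Fin n))) ?_ _ _ ?_ ?_
  · intro τ τ' h
    ext k
    have := congrFun h k
    simp only [Option.some.injEq] at this
    rw [this]
  · intro r hr
    -- An index function `r` that is not a permutation misses some `i`. Toggling `i` in `s` then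
    -- changes the sign but not the product, so the terms cancel in pairs.
    have hi : ∃ i, ∀ k, r k ≠ some i := by
      by_contra! hcon
      choose g hg using hcon
      have hinj : Function.Injective g := fun i j hij => by
        have := hg i
        rw [hij, hg j] at this
        exact (Option.some.inj this).symm
      have hbij : Function.Bijective g := Finite.injective_iff_bijective.1 hinj
      refine hr ⟨(Equiv.ofBijective g hbij).symm, funext fun k => ?_⟩
      change some ((Equiv.ofBijective g hbij).symm k) = r k
      rw [← hg ((Equiv.ofBijective g hbij).symm k)]
      congr 1
      exact (Equiv.ofBijective g hbij).apply_symm_apply k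
    obtain ⟨i, hi⟩ := hi
    convert zero_smul ℝ _
    have hmem : ∀ s : Finset (Fin n), ∀ j, j ∈ symmDiff s {i} ↔ if j = i then j ∉ s else j ∈ s := by
      intro s j
      by_cases hj : j = i <;> simp [Finset.mem_symmDiff, hj]
    refine Finset.sum_involution (fun s _ => symmDiff s {i}) ?_ ?_ (by simp) ?_
    · intro s _
      have h1 : ∀ k, c (symmDiff s {i}) (r k) = c s (r k) := by
        intro k
        rcases hrk : r k with _ | j
        · rfl
        · have hj : j ≠ i := fun h => hi k (by rw [hrk, h])
          simp [hc, hmem, hj]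
      have h2 : (∏ j, if j ∈ symmDiff s {i} then (1 : ℝ) else -1) =
          -∏ j, if j ∈ s then (1 : ℝ) else -1 := by
        rw [← Finset.mul_prod_erase _ _ (Finset.mem_univ i),
          ← Finset.mul_prod_erase _ (fun j => if j ∈ s then (1 : ℝ) else -1) (Finset.mem_univ i),
          ← neg_mul]
        congr 1
        · by_cases his : i ∈ s <;> simp [hmem, his]
        · refine Finset.prod_congr rfl fun j hj => ?_
          simp [hmem, (Finset.mem_erase.1 hj).1]
      simp only [h1, h2]
      ring
    · intro s _ _ h
      have := hmem s i
      rw [h] at this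
      simp at this
    · intro s _
      rw [symmDiff_assoc, symmDiff_self]
      exact symmDiff_bot s
  · intro τ
    -- A permutation uses every `u i`, so only `s = univ` contributes.
    rw [Finset.sum_eq_single Finset.univ]
    · simp [hc, hw]
    · intro s _ hs
      obtain ⟨i, hi⟩ : ∃ i, i ∉ s := by
        by_contra! h
        exact hs (Finset.eq_univ_iff_forall.2 h)
      have : ∏ k, c s (some (τ k)) = 0 :=
        Finset.prod_eq_zero (Finset.mem_univ (τ.symm i)) (by simp [hc, hi])
      rw [this, mul_zero]
    · simp

/-- The symmetrization of a multilinear map. -/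
noncomputable def symmetrization (β : MultilinearMap ℝ (fun _ : Fin n => E) F) :
    MultilinearMap ℝ (fun _ : Fin n => E) F :=
  (n.factorial : ℝ)⁻¹ • ∑ τ : Equiv.Perm (Fin n), β.domDomCongr τ

theorem symmetrization_apply (β : MultilinearMap ℝ (fun _ : Fin n => E) F) (u : Fin n → E) :
    symmetrization β u =
      (n.factorial : ℝ)⁻¹ • ∑ τ : Equiv.Perm (Fin n), β (fun i => u (τ i)) := by
  simp [symmetrization, MultilinearMap.domDomCongr_apply]

theorem symmetrization_diag (β : MultilinearMap ℝ (fun _ : Fin n => E) F) (x : E) :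
    symmetrization β (fun _ => x) = β fun _ => x := by
  rw [symmetrization_apply, Finset.sum_const, Finset.card_univ, Fintype.card_perm, Fintype.card_fin,
    ← Nat.cast_smul_eq_nsmul ℝ, smul_smul, inv_mul_cancel₀ (by positivity), one_smul]

/-- If the homogeneous polynomial defined by `β` is bounded on a ball with an arbitrary centre,
then its symmetrization is bounded on the ball centred at `0`, with an explicit constant. -/
theorem norm_symmetrization_le {F : Type*} [NormedAddCommGroup F] [NormedSpace ℝ F]
    (β : MultilinearMap ℝ (fun _ : Fin n => E) F) (q : Seminorm ℝ E) (a : E) {K : ℝ}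
    (h : ∀ x, q x ≤ 1 → ‖β fun _ => a + x‖ ≤ K) (u : Fin n → E) (hu : ∀ i, q (u i) ≤ 1) :
    ‖symmetrization β u‖ ≤ K * (2 * Real.exp 1) ^ n := by
  have hK : 0 ≤ K := (norm_nonneg _).trans (h 0 (by simp))
  rcases Nat.eq_zero_or_pos n with rfl | hn
  · have : u = fun _ => a + 0 := Subsingleton.elim _ _
    rw [this, symmetrization_diag]
    simpa using h 0 (by simp)
  have hn' : (0 : ℝ) < n := by exact_mod_cast hn
  -- Dividing each `u i` by `n` keeps all partial sums in the unit ball. This costs `n ^ n`, which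
  -- `1 / n!` reduces to `e ^ n`; the factor `2 ^ n` counts the subsets.
  have hnn : ((n : ℝ) ^ n)  / n.factorial ≤ Real.exp 1 ^ n := by
    have := Real.pow_div_factorial_le_exp (n : ℝ) hn'.le n
    rwa [← Real.exp_one_pow] at this
  have e1 : u = fun i => (n : ℝ) • ((n : ℝ)⁻¹ • u i) := by
    funext i
    rw [smul_smul, mul_inv_cancel₀ hn'.ne', one_smul]
  have e2 : symmetrization β u = ((n : ℝ) ^ n) • symmetrization β fun i => (n : ℝ)⁻¹ • u i := by
    conv_lhs => rw [e1]
    rw [MultilinearMap.map_smul_univ]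
    simp
  have e3 : ‖∑ τ : Equiv.Perm (Fin n), β fun i => (n : ℝ)⁻¹ • u (τ i)‖ ≤ 2 ^ n * K := by
    rw [← sum_sign_smul_diag_eq_sum_perm β a fun i => (n : ℝ)⁻¹ • u i]
    refine (norm_sum_le _ _).trans ((Finset.sum_le_card_nsmul _ _ K fun s _ => ?_).trans ?_)
    · have hs : ‖∏ i, if i ∈ s then (1 : ℝ) else -1‖ = 1 := by
        rw [norm_prod]
        refine Finset.prod_eq_one fun i _ => ?_
        split_ifs <;> simp
      rw [norm_smul, hs, one_mul]
      refine h _ ((Finset.le_sum_of_subadditive q (map_zero q).le (map_add_le_add q) s _).trans ?_)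
      calc ∑ i ∈ s, q ((n : ℝ)⁻¹ • u i) ≤ ∑ i ∈ s, (n : ℝ)⁻¹ := by
            refine Finset.sum_le_sum fun i _ => ?_
            rw [map_smul_eq_mul, norm_inv, Real.norm_of_nonneg hn'.le]
            exact mul_le_of_le_one_right (by positivity) (hu i)
        _ ≤ 1 := by
            rw [Finset.sum_const, nsmul_eq_mul, ← div_eq_mul_inv, div_le_one hn']
            exact_mod_cast (Finset.card_le_univ s).trans (by simp)
    · simp [Finset.card_univ, Fintype.card_finset]
  rw [e2, symmetrization_apply, smul_smul, norm_smul, ← div_eq_mul_inv,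
    Real.norm_of_nonneg (by positivity)]
  calc (n : ℝ) ^ n / n.factorial * _ ≤ Real.exp 1 ^ n * (2 ^ n * K) := by gcongr
    _ = K * (2 * Real.exp 1) ^ n := by rw [mul_pow]; ring

end Polarization

/-! ## Analytic maps on Baire spaces factor through normed spaces -/

section Analytic

/-- Near `p`, the map `f` is the composition of a continuous linear map to a normed space
and an analytic map. -/
def FactorsAnalyticAt {E : Type u} [AddCommGroup E] [Module ℝ E] [TopologicalSpace E]
    {F : Type*} [NormedAddCommGroup F] [NormedSpace ℝ F] (f : E → F) (p : E) : Prop :=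
  ∃ (X : Type u) (_ : NormedAddCommGroup X) (_ : NormedSpace ℝ X) (l : E →L[ℝ] X) (g : X → F),
    AnalyticAt ℝ g 0 ∧ ∀ᶠ v in 𝓝 0, f (p + v) = g (l v)

variable {E : Type u} [AddCommGroup E] [Module ℝ E] [TopologicalSpace E]
    {F : Type*} [NormedAddCommGroup F] [NormedSpace ℝ F]

/-- In a Baire space, a pointwise convergent series of homogeneous polynomials is bounded on some
ball, whose centre need not be `0`. -/
theorem exists_ball_bound_of_hasSum [IsTopologicalAddGroup E] [ContinuousSMul ℝ E]
    [LocallyConvexSpace ℝ E] [BaireSpace E] {V : Set E}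
    (hV : V ∈ 𝓝 (0 : E)) {β : (n : ℕ) → ContinuousMultilinearMap ℝ (fun _ : Fin n => E) F}
    (hβ : ∀ v ∈ V, Summable fun n => β n fun _ => v) :
    ∃ (q : Seminorm ℝ E) (a : E) (K : ℝ), Continuous q ∧ {v | q v ≤ 1} ⊆ V ∧
      ∀ x, q x ≤ 1 → ∀ n, ‖β n fun _ => a + x‖ ≤ K := by
  have hcont : ∀ n, Continuous fun v : E => ‖β n fun _ => v‖ := fun n =>
    ((β n).cont.comp (continuous_pi fun _ => continuous_id)).norm
  -- Adjoining the complement of `interior V` makes these closed sets cover all of `E`, so that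
  -- Baire applies to `E` itself.
  set f : ℕ → Set E := fun k => {v | ∀ n, ‖β n fun _ => v‖ ≤ k} ∪ (interior V)ᶜ with hf
  have hclosed : ∀ k, IsClosed (f k) := by
    intro k
    refine IsClosed.union ?_ isOpen_interior.isClosed_compl
    rw [ofPred_forall]
    exact isClosed_iInter fun n => isClosed_le (hcont n) continuous_const
  have hcover : ⋃ k, f k = univ := by
    refine eq_univ_of_forall fun v => ?_
    by_cases hv : v ∈ interior V
    · have ht := (hβ v (interior_subset hv)).tendsto_atTop_zero.norm.bddAbove_range
      obtain ⟨M, hM⟩ := ht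
      obtain ⟨k, hk⟩ := exists_nat_ge M
      exact mem_iUnion.2 ⟨k, Or.inl fun n => (hM ⟨n, rfl⟩).trans hk⟩
    · exact mem_iUnion.2 ⟨0, Or.inr hv⟩
  have hdense := dense_iUnion_interior_of_closed hclosed hcover
  obtain ⟨a, haV, ha⟩ := hdense.inter_open_nonempty (interior V) isOpen_interior
    ⟨0, mem_interior_iff_mem_nhds.2 hV⟩
  obtain ⟨k, hk⟩ := mem_iUnion.1 ha
  have hnhds : {v : E | ∀ n, ‖β n fun _ => v‖ ≤ k} ∈ 𝓝 a := by
    filter_upwards [isOpen_interior.mem_nhds hk, isOpen_interior.mem_nhds haV] with x hx hxV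
    rcases interior_subset hx with h | h
    · exact h
    · exact absurd hxV h
  have hW : {x : E | ∀ n, ‖β n fun _ => a + x‖ ≤ k} ∈ 𝓝 (0 : E) := by
    have : Tendsto (fun x : E => a + x) (𝓝 0) (𝓝 a) := by
      simpa using (continuous_const_add a).tendsto (0 : E)
    exact this hnhds
  obtain ⟨q, hq, hqs⟩ := exists_continuous_seminorm_ball_subset (inter_mem hW hV)
  exact ⟨q, a, k, hq, fun v hv => (hqs hv).2, fun x hx => (hqs hx).1⟩

/-- A priori each coefficient is controlled by its own seminorm. Baire and polarization give a
single `q` with geometric bounds for all symmetrized coefficients, which descend to the normed space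
of `q` as a power series converging on the ball of radius `1 / (2e)`. -/
theorem AnalyticOn.factorsAnalyticAt [IsTopologicalAddGroup E] [ContinuousSMul ℝ E]
    [LocallyConvexSpace ℝ E] [BaireSpace E] {f : E → F}
    {U : Set E} (h : AnalyticOn f U) {p : E} (hp : p ∈ U) : FactorsAnalyticAt f p := by
  obtain ⟨V, hV, β, hβ⟩ := h.2 p hp
  obtain ⟨q, a, K, hq, hqV, hK⟩ := exists_ball_bound_of_hasSum hV fun v hv => (hβ v hv).summable
  have hK0 : 0 ≤ K := (norm_nonneg _).trans (hK 0 (by simp) 0)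
  obtain ⟨X, iX, iX', l, σ, hσ, hl⟩ := exists_normedSpace_of_seminorm q
  have hlc : Continuous l := by
    refine continuous_of_continuousAt_zero l ?_
    rw [ContinuousAt, map_zero, tendsto_zero_iff_norm_tendsto_zero]
    simp_rw [hl]
    simpa using hq.tendsto 0
  choose m hm hmβ using fun n => exists_continuousMultilinearMap_of_ball hσ hl
    (symmetrization (β n).toMultilinearMap) (C := K * (2 * Real.exp 1) ^ n) (by positivity)
    (norm_symmetrization_le (β n).toMultilinearMap q a fun x hx => hK x hx n)
  have hdiag : ∀ n x, (β n fun _ => x) = m n fun _ => l x := by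
    intro n x
    rw [← hmβ n fun _ => x, symmetrization_diag]
    rfl
  have hsum : ∀ v, q v ≤ 1 → HasSum (fun n => m n fun _ => l v) (f (p + v)) := by
    intro v hv
    simpa only [hdiag] using hβ v (hqV hv)
  have he : 0 < 2 * Real.exp 1 := by positivity
  have he1 : (2 * Real.exp 1)⁻¹ ≤ 1 := by
    apply inv_le_one_of_one_le₀
    have := Real.add_one_le_exp (1 : ℝ)
    linarith
  obtain ⟨r, hr⟩ : ∃ r : NNReal, (r : ℝ) = (2 * Real.exp 1)⁻¹ :=
    ⟨NNReal.mk _ (by positivity), rfl⟩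
  have hball : HasFPowerSeriesOnBall (fun y => f (p + σ y)) (fun n => m n) 0 r := by
    refine ⟨?_, ?_, ?_⟩
    · refine FormalMultilinearSeries.le_radius_of_bound _ K fun n => ?_
      calc ‖m n‖ * (r : ℝ) ^ n ≤ K * (2 * Real.exp 1) ^ n * (r : ℝ) ^ n :=
            mul_le_mul_of_nonneg_right (hm n) (by positivity)
        _ = K := by
            rw [mul_assoc, ← mul_pow, hr, mul_inv_cancel₀ he.ne', one_pow, mul_one]
    · have : (0 : ℝ) < r := hr ▸ inv_pos.2 he
      exact_mod_cast this
    · intro y hy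
      have hy' : ‖y‖ < (2 * Real.exp 1)⁻¹ := by
        have : y ∈ Metric.ball (0 : X) r := by
          rwa [← Metric.eball_coe]
        rwa [mem_ball_zero_iff, hr] at this
      have hqy : q (σ y) ≤ 1 := by
        rw [← hl, hσ]
        exact hy'.le.trans he1
      simpa [hσ] using hsum (σ y) hqy
  refine ⟨X, iX, iX', ⟨l, hlc⟩, fun y => f (p + σ y), ⟨_, r, hball⟩, ?_⟩
  have hev : ∀ᶠ v in 𝓝 (0 : E), q v < 1 := by
    have : Tendsto q (𝓝 0) (𝓝 0) := by simpa using hq.tendsto 0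
    exact this.eventually (gt_mem_nhds one_pos)
  filter_upwards [hev] with v hv
  -- Both `v` and `σ (l v)` give the same series, so `f (p + v)` depends only on `l v`.
  have h1 := hsum v hv.le
  have h2 := hsum (σ (l v)) (by rw [← hl, hσ, hl]; exact hv.le)
  simp only [hσ] at h2
  exact h1.unique h2

namespace FactorsAnalyticAt

theorem continuousAt [IsTopologicalAddGroup E] {f : E → F} {p : E} (h : FactorsAnalyticAt f p) :
    ContinuousAt f p := by
  obtain ⟨X, _, _, l, g, hg, hfg⟩ := h
  have h1 : ContinuousAt (fun v => g (l v)) (0 : E) :=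
    ContinuousAt.comp (by simpa using hg.continuousAt) l.continuous.continuousAt
  have h2 : ContinuousAt (fun v => f (p + v)) (0 : E) := h1.congr (hfg.mono fun v hv => hv.symm)
  have h3 : ContinuousAt (fun x : E => -p + x) p := by fun_prop
  have h4 : ContinuousAt ((fun v => f (p + v)) ∘ fun x : E => -p + x) p :=
    ContinuousAt.comp (by simpa using h2) h3
  simpa [Function.comp_def] using h4

theorem analyticOn [IsTopologicalAddGroup E] {f : E → F} {U : Set E}
    (h : ∀ p ∈ U, FactorsAnalyticAt f p) :
    AnalyticOn f U := by
  refine ⟨fun p hp => (h p hp).continuousAt.continuousWithinAt, fun p hp => ?_⟩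
  obtain ⟨X, _, _, l, g, ⟨P, r, hg⟩, hfg⟩ := h p hp
  have hb : ∀ᶠ v in 𝓝 (0 : E), l v ∈ Metric.eball (0 : X) r := by
    have : Tendsto l (𝓝 0) (𝓝 0) := by simpa using l.continuous.tendsto 0
    exact this.eventually (Metric.eball_mem_nhds _ hg.r_pos)
  refine ⟨_, hb.and hfg, fun n => (P n).compContinuousLinearMap fun _ => l, fun v hv => ?_⟩
  have := hg.hasSum hv.1
  rw [zero_add, ← hv.2] at this
  exact this

/-- Once `f` factors through `l`, only `l ∘ h` matters. It has normed values, so it factors in turn,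
and two analytic maps between normed spaces are composed. -/
theorem comp [IsTopologicalAddGroup E] {f : E → F} {E' : Type v} [AddCommGroup E']
    [Module ℝ E'] [TopologicalSpace E']
    [IsTopologicalAddGroup E'] [ContinuousSMul ℝ E'] [LocallyConvexSpace ℝ E'] [BaireSpace E']
    {h : E' → E} {V : Set E'} (hh : AnalyticOn h V) {p : E'} (hV : V ∈ 𝓝 p)
    (hf : FactorsAnalyticAt f (h p)) : FactorsAnalyticAt (fun x => f (h x)) p := by
  have hp : p ∈ V := mem_of_mem_nhds hV
  obtain ⟨X, _, _, l, g, hg, hfg⟩ := hf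
  have hlh : AnalyticOn (fun x => l (h x)) V := by
    refine ⟨l.continuous.comp_continuousOn hh.1, fun x hx => ?_⟩
    obtain ⟨W, hW, β, hβ⟩ := hh.2 x hx
    exact ⟨W, hW, fun n => l.compContinuousMultilinearMap (β n), fun v hv =>
      (hβ v hv).mapL l⟩
  obtain ⟨Y, iY, iY', l', g', hg', hfg'⟩ := hlh.factorsAnalyticAt hp
  have h0 : g' 0 = l (h p) := by
    have := hfg'.self_of_nhds
    simpa using this.symm
  refine ⟨Y, iY, iY', l', fun y => g (g' y - l (h p)), ?_, ?_⟩
  · refine AnalyticAt.fun_comp (g := g) (f := fun y => g' y - l (h p)) ?_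
      (hg'.sub analyticAt_const)
    simpa [h0] using hg
  · have hc : Tendsto (fun v => h (p + v) - h p) (𝓝 0) (𝓝 0) := by
      have h1 : ContinuousAt h p := hh.1.continuousAt hV
      have h2 : Tendsto (fun v : E' => p + v) (𝓝 0) (𝓝 p) := by
        simpa using (continuous_const_add p).tendsto (0 : E')
      simpa using (h1.tendsto.comp h2).sub_const (h p)
    filter_upwards [hfg', hc.eventually hfg] with v hv hv'
    rw [add_sub_cancel] at hv'
    rw [hv', map_sub, hv]

theorem ckOn [IsTopologicalAddGroup E] [ContinuousSMul ℝ E] [CompleteSpace F] [T2Space E]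
    {f : E → F} {U : Set E}
    (h : ∀ p ∈ U, FactorsAnalyticAt f p) (k : ℕ) : CkOn k f U := by
  refine CkOn.of_locally fun p hp => ?_
  obtain ⟨X, _, _, l, g, hg, hfg⟩ := h p hp
  obtain ⟨O, hO, hOo, h0O⟩ := eventually_nhds_iff.1 hg.eventually_analyticAt
  have hgO : CkOn k g O := CkOn.of_contDiffOn hOo fun x hx =>
    ((hO x hx).contDiffAt (n := (k : WithTop ℕ∞))).contDiffWithinAt
  obtain ⟨W, hW, hWo, h0W⟩ := eventually_nhds_iff.1 hfg
  have h1 : CkOn k (fun v => g (l v)) (l ⁻¹' O) :=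
    hgO.comp_linear l.continuous (by simp)
  have h2 : CkOn k (fun v => f (p + v)) (W ∩ l ⁻¹' O) :=
    (h1.mono inter_subset_right).congr (hWo.inter (hOo.preimage l.continuous))
      fun v hv => (hW v hv.1).symm
  have h3 := h2.comp_add_const (-p)
  refine ⟨(· + -p) ⁻¹' (W ∩ l ⁻¹' O),
    (hWo.inter (hOo.preimage l.continuous)).preimage (by fun_prop), ?_, ?_⟩
  · simpa using ⟨h0W, h0O⟩
  · simpa using h3

/-- A continuous bilinear map applied to two factoring maps in separate variables. -/
theorem bilinear {E₂ : Type v} [AddCommGroup E₂] [Module ℝ E₂] [TopologicalSpace E₂]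
    {F₁ F₂ : Type*} [NormedAddCommGroup F₁] [NormedSpace ℝ F₁] [NormedAddCommGroup F₂]
    [NormedSpace ℝ F₂] (B : F₁ →L[ℝ] F₂ →L[ℝ] F) {f₁ : E → F₁} {f₂ : E₂ → F₂} {p₁ : E} {p₂ : E₂}
    (h₁ : FactorsAnalyticAt f₁ p₁) (h₂ : FactorsAnalyticAt f₂ p₂) :
    FactorsAnalyticAt (fun x : E × E₂ => B (f₁ x.1) (f₂ x.2)) (p₁, p₂) := by
  obtain ⟨X₁, _, _, l₁, g₁, hg₁, hfg₁⟩ := h₁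
  obtain ⟨X₂, _, _, l₂, g₂, hg₂, hfg₂⟩ := h₂
  refine ⟨X₁ × X₂, inferInstance, inferInstance, l₁.prodMap l₂,
    fun y => B (g₁ y.1) (g₂ y.2), ?_, ?_⟩
  · have e₁ : AnalyticAt ℝ (fun y : X₁ × X₂ => g₁ y.1) 0 :=
      AnalyticAt.fun_comp (g := g₁) (f := Prod.fst) hg₁ analyticAt_fst
    have e₂ : AnalyticAt ℝ (fun y : X₁ × X₂ => g₂ y.2) 0 :=
      AnalyticAt.fun_comp (g := g₂) (f := Prod.snd) hg₂ analyticAt_snd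
    exact AnalyticAt.fun_comp (g := fun y : F₁ × F₂ => B y.1 y.2)
      (f := fun y : X₁ × X₂ => (g₁ y.1, g₂ y.2)) (B.analyticAt_bilinear _) (e₁.prod e₂)
  · have : (0 : E × E₂) = (0, 0) := rfl
    rw [this, nhds_prod_eq]
    filter_upwards [hfg₁.prod_mk hfg₂] with v hv
    simp [hv.1, hv.2]

/-- Continuity at `0` bounds `Ψ` on the unit ball of one seminorm, so `Ψ` descends to a continuous
multilinear map on a normed space, which is then recentred at the image of `p`. -/
theorem of_continuousMultilinearMap [IsTopologicalAddGroup E] [ContinuousSMul ℝ E]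
    [LocallyConvexSpace ℝ E] {n : ℕ}
    (Ψ : ContinuousMultilinearMap ℝ (fun _ : Fin n => E) F) (p : Fin n → E) :
    FactorsAnalyticAt Ψ p := by
  have h1 : ∀ᶠ u : Fin n → E in 𝓝 0, ‖Ψ u‖ < ‖Ψ 0‖ + 1 :=
    (Ψ.cont.norm.tendsto 0).eventually (gt_mem_nhds (by simp))
  obtain ⟨W, hW, hWs⟩ : ∃ W ∈ 𝓝 (0 : E), ∀ u : Fin n → E, (∀ i, u i ∈ W) → ‖Ψ u‖ < ‖Ψ 0‖ + 1 := by
    rw [nhds_pi, Filter.eventually_iff, Filter.mem_pi] at h1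
    obtain ⟨I, hI, t, ht, hts⟩ := h1
    refine ⟨⋂ i, t i, (Filter.iInter_mem).2 fun i => ht i, fun u hu => hts fun i _ => ?_⟩
    exact mem_iInter.1 (hu i) i
  obtain ⟨q, hq, hqW⟩ := exists_continuous_seminorm_ball_subset hW
  obtain ⟨X, iX, iX', l, σ, hσ, hl⟩ := exists_normedSpace_of_seminorm q
  have hlc : Continuous l := by
    refine continuous_of_continuousAt_zero l ?_
    rw [ContinuousAt, map_zero, tendsto_zero_iff_norm_tendsto_zero]
    simp_rw [hl]
    simpa using hq.tendsto 0
  obtain ⟨m, -, hm⟩ := exists_continuousMultilinearMap_of_ball hσ hl Ψ.toMultilinearMap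
    (C := ‖Ψ 0‖ + 1) (by positivity) fun u hu => (hWs u fun i => hqW (hu i)).le
  refine ⟨Fin n → X, inferInstance, inferInstance,
    ContinuousLinearMap.pi fun i => (⟨l, hlc⟩ : E →L[ℝ] X).comp (ContinuousLinearMap.proj i),
    fun y => m ((fun i => l (p i)) + y), ?_, Eventually.of_forall fun v => ?_⟩
  · exact AnalyticAt.fun_comp (g := m) (f := fun y => (fun i => l (p i)) + y) m.analyticAt
      (analyticAt_const.add analyticAt_id)
  · refine (hm (p + v)).trans ?_
    congr 1
    ext i
    simp

end FactorsAnalyticAt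

end Analytic

/-! ## Calculus rules that hold for smooth and for analytic maps -/

section Regularity

variable {E : Type u} [AddCommGroup E] [Module ℝ E] [TopologicalSpace E]
  [IsTopologicalAddGroup E]
  {F : Type*} [NormedAddCommGroup F] [NormedSpace ℝ F]

theorem AnalyticOn.congr {f g : E → F} {U : Set E} (hU : IsOpen U) (h : AnalyticOn f U)
    (hfg : EqOn f g U) : AnalyticOn g U := by
  refine ⟨h.1.congr fun p hp => (hfg hp).symm, fun p hp => ?_⟩
  obtain ⟨V, hV, β, hβ⟩ := h.2 p hp
  have hW : {v : E | p + v ∈ U} ∈ 𝓝 (0 : E) := by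
    have : Tendsto (fun v : E => p + v) (𝓝 0) (𝓝 p) := by
      simpa using (continuous_const_add p).tendsto (0 : E)
    exact this (hU.mem_nhds hp)
  exact ⟨_, inter_mem hV hW, β, fun v hv => hfg hv.2 ▸ hβ v hv.1⟩

variable [ContinuousSMul ℝ E]

namespace RegOn

theorem congr {r : Regularity} {f g : E → F} {U : Set E} (hU : IsOpen U) (h : RegOn r f U)
    (hfg : EqOn f g U) : RegOn r g U := by
  cases r with
  | smooth => exact smoothOn_of_forall_ckOn fun k => (SmoothOn.ckOn hU h k).congr hU hfg
  | analytic => exact AnalyticOn.congr hU h hfg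

theorem of_locally {r : Regularity} {f : E → F} {U : Set E}
    (h : ∀ p ∈ U, ∃ V, IsOpen V ∧ p ∈ V ∧ RegOn r f V) : RegOn r f U := by
  cases r with
  | smooth =>
    refine smoothOn_of_forall_ckOn fun k => CkOn.of_locally fun p hp => ?_
    obtain ⟨V, hV, hpV, hf⟩ := h p hp
    exact ⟨V, hV, hpV, SmoothOn.ckOn hV hf k⟩
  | analytic =>
    refine ⟨fun p hp => ?_, fun p hp => ?_⟩
    · obtain ⟨V, hV, hpV, hf⟩ := h p hp
      exact (hf.1.continuousAt (hV.mem_nhds hpV)).continuousWithinAt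
    · obtain ⟨V, hV, hpV, hf⟩ := h p hp
      exact hf.2 p hpV

theorem ckOn [LocallyConvexSpace ℝ E] [T2Space E] [BaireSpace E] [CompleteSpace F]
    {r : Regularity} {f : E → F} {U : Set E} (hU : IsOpen U) (h : RegOn r f U) (k : ℕ) :
    CkOn k f U := by
  cases r with
  | smooth => exact SmoothOn.ckOn hU h k
  | analytic => exact FactorsAnalyticAt.ckOn (fun p hp => AnalyticOn.factorsAnalyticAt h hp) k

theorem comp [LocallyConvexSpace ℝ E] [T2Space E] [BaireSpace E]
    {E' : Type v} [AddCommGroup E'] [Module ℝ E'] [TopologicalSpace E']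
    [IsTopologicalAddGroup E'] [ContinuousSMul ℝ E'] [LocallyConvexSpace ℝ E'] [BaireSpace E']
    {r : Regularity} {f : E → F} {h : E' → E} {U : Set E} {V : Set E'} (hU : IsOpen U)
    (hV : IsOpen V) (hf : RegOn r f U) (hh : RegOn r h V) (hVU : MapsTo h V U) :
    RegOn r (fun x => f (h x)) V := by
  cases r with
  | smooth =>
    exact smoothOn_of_forall_ckOn fun k =>
      CkOn.comp hU hV (SmoothOn.ckOn hU hf k) (SmoothOn.ckOn hV hh k) hVU
  | analytic =>
    exact FactorsAnalyticAt.analyticOn fun p hp => FactorsAnalyticAt.comp hh (hV.mem_nhds hp)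
      (AnalyticOn.factorsAnalyticAt hf (hVU hp))

theorem bilinear [LocallyConvexSpace ℝ E] [BaireSpace E]
    {E₂ : Type v} [AddCommGroup E₂] [Module ℝ E₂] [TopologicalSpace E₂]
    [IsTopologicalAddGroup E₂] [ContinuousSMul ℝ E₂] [LocallyConvexSpace ℝ E₂] [BaireSpace E₂]
    {F₁ F₂ : Type*} [NormedAddCommGroup F₁] [NormedSpace ℝ F₁] [NormedAddCommGroup F₂]
    [NormedSpace ℝ F₂] (B : F₁ →L[ℝ] F₂ →L[ℝ] F) {r : Regularity} {f₁ : E → F₁} {f₂ : E₂ → F₂}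
    {U₁ : Set E} {U₂ : Set E₂} (hU₁ : IsOpen U₁) (hU₂ : IsOpen U₂)
    (h₁ : RegOn r f₁ U₁) (h₂ : RegOn r f₂ U₂) :
    RegOn r (fun x : E × E₂ => B (f₁ x.1) (f₂ x.2)) (U₁ ×ˢ U₂) := by
  cases r with
  | smooth =>
    refine smoothOn_of_forall_ckOn fun k => ?_
    have hB : CkOn k (fun y : F₁ × F₂ => B y.1 y.2) univ :=
      CkOn.of_contDiffOn isOpen_univ B.isBoundedBilinearMap.contDiff.contDiffOn
    refine CkOn.comp (h := fun x : E × E₂ => (f₁ x.1, f₂ x.2)) isOpen_univ (hU₁.prod hU₂) hB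
      (CkOn.prodMk (hU₁.prod hU₂) ?_ ?_) (mapsTo_univ _ _)
    · exact ((SmoothOn.ckOn hU₁ h₁ k).comp_linear (A := fun x : E × E₂ => x.1) continuous_fst
        (by simp)).mono fun q hq => hq.1
    · exact ((SmoothOn.ckOn hU₂ h₂ k).comp_linear (A := fun x : E × E₂ => x.2) continuous_snd
        (by simp)).mono fun q hq => hq.2
  | analytic =>
    exact FactorsAnalyticAt.analyticOn fun p hp => FactorsAnalyticAt.bilinear B
      (AnalyticOn.factorsAnalyticAt h₁ hp.1) (AnalyticOn.factorsAnalyticAt h₂ hp.2)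

theorem of_continuousMultilinearMap [LocallyConvexSpace ℝ E] [T2Space E] [CompleteSpace F] {n : ℕ}
    (r : Regularity) (Ψ : ContinuousMultilinearMap ℝ (fun _ : Fin n => E) F) : RegOn r Ψ univ := by
  have h : ∀ p ∈ (univ : Set (Fin n → E)), FactorsAnalyticAt Ψ p := fun p _ =>
    FactorsAnalyticAt.of_continuousMultilinearMap Ψ p
  cases r with
  | smooth => exact smoothOn_of_forall_ckOn (FactorsAnalyticAt.ckOn h)
  | analytic => exact FactorsAnalyticAt.analyticOn h

end RegOn

section Manifolds

variable {M : Type*} [TopologicalSpace M]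

theorem regMap_selfAtlas_iff {F : Type*} [AddCommGroup F] [Module ℝ F] [TopologicalSpace F]
    {E : Type*} [AddCommGroup E] [Module ℝ E] [TopologicalSpace E] {r : Regularity}
    {A : Set (OpenPartialHomeomorph M E)} {f : M → F} :
    RegMap r A (selfAtlas F) f ↔
      Continuous f ∧ ∀ φ ∈ A, RegOn r (fun p => f (φ.symm p)) φ.target := by
  simp [RegMap, selfAtlas, Function.comp_def]

/-- Regularity is local, so near each point the chart of `N` at the image point can be inserted,
which leaves the chain rule between model spaces. -/
theorem RegMap.comp_of_chartedSpace [LocallyConvexSpace ℝ E] [T2Space E] [BaireSpace E]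
    {E' : Type v} [AddCommGroup E'] [Module ℝ E'] [TopologicalSpace E']
    [IsTopologicalAddGroup E'] [ContinuousSMul ℝ E'] [LocallyConvexSpace ℝ E'] [BaireSpace E']
    {N : Type*} [TopologicalSpace N] [ChartedSpace E N] {r : Regularity}
    {A : Set (OpenPartialHomeomorph M E')} {f : N → F} {h : M → N}
    (hf : RegMap r (atlas E N) (selfAtlas F) f) (hh : RegMap r A (atlas E N) h) :
    RegMap r A (selfAtlas F) (fun x => f (h x)) := by
  rw [regMap_selfAtlas_iff] at hf ⊢
  refine ⟨hf.1.comp hh.1, fun φ hφ => RegOn.of_locally fun p hp => ?_⟩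
  have hψ := chart_mem_atlas E (h (φ.symm p))
  set ψ := chartAt E (h (φ.symm p)) with hψd
  have hVo : IsOpen (φ.target ∩ φ.symm ⁻¹' (h ⁻¹' ψ.source)) :=
    φ.isOpen_inter_preimage_symm (ψ.open_source.preimage hh.1)
  refine ⟨_, hVo, ⟨hp, mem_chart_source E (h (φ.symm p))⟩, ?_⟩
  have hc := RegOn.comp ψ.open_target hVo (hf.2 ψ hψ) (hh.2 φ hφ ψ hψ)
    fun x hx => ψ.map_source hx.2
  refine hc.congr hVo fun x hx => ?_
  simp only [Function.comp]
  rw [ψ.left_inv hx.2]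

end Manifolds

end Regularity

/-! ## Continuity of linear maps on barrelled spaces -/

section Barrelled

variable {E : Type*} [AddCommGroup E] [Module ℝ E] [TopologicalSpace E] [IsTopologicalAddGroup E]
  [BarrelledSpace ℝ E]

/-- A separately continuous map that is linear in the second variable is jointly continuous. -/
theorem continuous_of_separately_of_barrelled [FirstCountableTopology E]
    {X : Type*} [TopologicalSpace X] [FirstCountableTopology X]
    {F : Type*} [NormedAddCommGroup F] [NormedSpace ℝ F] (f : X → E →ₗ[ℝ] F)
    (h₁ : ∀ x, Continuous (f x)) (h₂ : ∀ y, Continuous fun x => f x y) :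
    Continuous fun z : X × E => f z.1 z.2 := by
  refine continuous_iff_seqContinuous.2 fun z z₀ hz => ?_
  have hx : Tendsto (fun n => (z n).1) atTop (𝓝 z₀.1) := (continuous_fst.tendsto _).comp hz
  have hy : Tendsto (fun n => (z n).2) atTop (𝓝 z₀.2) := (continuous_snd.tendsto _).comp hz
  -- Along a convergent sequence these seminorms are pointwise bounded, so on a barrelled space
  -- their supremum is continuous. It controls `f(x_n)(y_n - y₀)` uniformly.
  set p : ℕ → Seminorm ℝ E := fun n => (normSeminorm ℝ F).comp (f (z n).1) with hp
  have hpn : ∀ n y, p n y = ‖f (z n).1 y‖ := fun n y => rfl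
  have hbdd : ∀ y, BddAbove (range fun n => p n y) := fun y => by
    simp_rw [hpn]
    exact (((h₂ y).tendsto z₀.1).comp hx).norm.bddAbove_range
  have hPc := Seminorm.continuous_iSup p (fun n => (h₁ _).norm)
    (Seminorm.bddAbove_range_iff.2 hbdd)
  have h0 : Tendsto (fun n => f (z n).1 ((z n).2 - z₀.2)) atTop (𝓝 0) := by
    rw [tendsto_zero_iff_norm_tendsto_zero]
    have hlim : Tendsto (fun n => (⨆ i, ⇑(p i)) ((z n).2 - z₀.2)) atTop (𝓝 0) := by
      have e0 : (⨆ i, ⇑(p i)) 0 = 0 := by simp [iSup_apply]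
      have h1 : Tendsto (fun n => (z n).2 - z₀.2) atTop (𝓝 0) := by
        simpa using hy.sub_const z₀.2
      have := (hPc.tendsto 0).comp h1
      rwa [e0] at this
    refine squeeze_zero (fun n => norm_nonneg _) (fun n => ?_) hlim
    rw [iSup_apply]
    exact le_ciSup (hbdd _) n
  have := h0.add (((h₂ z₀.2).tendsto z₀.1).comp hx)
  rw [zero_add] at this
  refine this.congr fun n => ?_
  simp

/-- A linear map to a Hilbert space that is weakly continuous with respect to a dense subspace
is continuous. -/
theorem continuous_of_continuous_inner_of_barrelled {H : Type*} [NormedAddCommGroup H]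
    [InnerProductSpace ℂ H] {B : Submodule ℂ H} (hB : Dense (B : Set H)) (T : E →ₗ[ℝ] H)
    (h : ∀ u ∈ B, Continuous fun x => inner ℂ u (T x)) : Continuous T := by
  -- The supremum over the unit ball of `B` is finite, since it is bounded by `‖T x‖`, and
  -- continuous by barrelledness. By density of `B` it also bounds `‖T x‖` from above.
  set p : {u : B // ‖u‖ ≤ 1} → Seminorm ℝ E := fun u => (normSeminorm ℝ ℂ).comp
    (((innerSL ℂ (u.1 : H)).restrictScalars ℝ).toLinearMap ∘ₗ T) with hp
  have hpn : ∀ u x, p u x = ‖inner ℂ (u.1 : H) (T x)‖ := fun u x => rfl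
  have hle : ∀ u x, p u x ≤ ‖T x‖ := fun u x => by
    rw [hpn]
    refine (norm_inner_le_norm _ _).trans (mul_le_of_le_one_left (norm_nonneg _) u.2)
  have hbdd : ∀ x, BddAbove (range fun u => p u x) := fun x => ⟨‖T x‖, by
    rintro _ ⟨u, rfl⟩
    exact hle u x⟩
  have hPc := Seminorm.continuous_iSup p (fun u => (h _ u.1.2).norm)
    (Seminorm.bddAbove_range_iff.2 hbdd)
  set Q : E → ℝ := ⨆ i, ⇑(p i) with hQ
  have hQ0 : Q 0 = 0 := by simp [hQ, iSup_apply]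
  have hpQ : ∀ u x, p u x ≤ Q x := fun u x => by
    rw [hQ, iSup_apply]
    exact le_ciSup (hbdd x) u
  have hTQ : ∀ x, ‖T x‖ ≤ Q x := by
    intro x
    have hQx : 0 ≤ Q x := (apply_nonneg (p ⟨0, by simp⟩) x).trans (hpQ ⟨0, by simp⟩ x)
    have key : ∀ u : H, ‖inner ℂ u (T x)‖ ≤ Q x * ‖u‖ := by
      intro u
      refine hB.induction (P := fun u => ‖inner ℂ u (T x)‖ ≤ Q x * ‖u‖) (fun u hu => ?_)
        (isClosed_le (by fun_prop) (by fun_prop)) u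
      rcases eq_or_ne u 0 with rfl | hu0
      · simp
      · have hn : 0 < ‖u‖ := norm_pos_iff.2 hu0
        have := hpQ ⟨⟨((‖u‖⁻¹ : ℝ) : ℂ) • u, B.smul_mem _ hu⟩, by
          change ‖((‖u‖⁻¹ : ℝ) : ℂ) • u‖ ≤ 1
          rw [norm_smul, Complex.norm_real, norm_inv, norm_norm, inv_mul_cancel₀ hn.ne']⟩ x
        rw [hpn, inner_smul_left, norm_mul, Complex.norm_conj, Complex.norm_real, norm_inv,
          norm_norm, inv_mul_le_iff₀ hn] at this
        rwa [mul_comm]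
    have := key (T x)
    rw [inner_self_eq_norm_sq_to_K] at this
    rcases eq_or_ne (T x) 0 with h0 | h0
    · rwa [h0, norm_zero]
    · have hn : 0 < ‖T x‖ := norm_pos_iff.2 h0
      simp only [Complex.coe_algebraMap, norm_pow, Complex.norm_real, norm_norm] at this
      nlinarith
  refine continuous_of_continuousAt_zero T ?_
  rw [ContinuousAt, map_zero, tendsto_zero_iff_norm_tendsto_zero]
  refine squeeze_zero (fun x => norm_nonneg _) hTQ ?_
  simpa [hQ0] using hPc.tendsto 0

end Barrelled

/-! ## The representation of the enveloping algebra -/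

section ExpMap

variable {E G : Type*} [AddCommGroup E] [Module ℝ E] [TopologicalSpace E]
  [Group G] [TopologicalSpace G] [ChartedSpace E G]

theorem IsExpMap.map_zero {e : E → G} (he : IsExpMap e) : e 0 = 1 := by
  have := he.add 0 0 0
  simpa using this

/-- The derivative of a differentiable map along a one-parameter group. -/
theorem IsExpMap.hasDerivAt [IsTopologicalAddGroup E] [ContinuousSMul ℝ E]
    {F : Type*} [NormedAddCommGroup F] [NormedSpace ℝ F]
    {e : E → G} (he : IsExpMap e) {f : G → F}
    (hf : CkOn 1 (fun p => f ((chartAt E (1 : G)).symm p)) (chartAt E (1 : G)).target) (x : E) :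
    HasDerivAt (fun t : ℝ => f (e (t • x)))
      (dirDeriv (fun p => f ((chartAt E (1 : G)).symm p)) (chartAt E (1 : G) 1, x)) 0 := by
  set φ := chartAt E (1 : G) with hφ
  have h1 : (1 : G) ∈ φ.source := mem_chart_source E 1
  -- In the chart, `e (t • x)` is `φ 1 + t • W t` with `W t → x`; it need not be a straight line,
  -- hence the varying direction.
  have := tendsto_slope_of_continuousOn φ.open_target hf.2.1 hf.2.2.continuousOn
    (φ.map_source h1) (Q := fun _ => φ 1) tendsto_const_nhds (he.velocity x)
  rw [hasDerivAt_iff_tendsto_slope_zero]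
  refine Tendsto.congr' ?_ this
  have hc : Tendsto (fun t : ℝ => e (t • x)) (𝓝[≠] 0) (𝓝 1) := by
    have := (he.smooth x).1.tendsto 0
    simp only [zero_smul, he.map_zero] at this
    exact this.mono_left nhdsWithin_le_nhds
  filter_upwards [hc (φ.open_source.mem_nhds h1), self_mem_nhdsWithin] with t ht ht0
  have ht0 : t ≠ 0 := ht0
  have ht : e (t • x) ∈ φ.source := ht
  rw [smul_smul, mul_inv_cancel₀ ht0, one_smul, add_sub_cancel, φ.left_inv ht, φ.left_inv h1,
    zero_add, zero_smul, he.map_zero]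

end ExpMap

theorem LieSuperalgebra.monomial_succ {𝔤₀ 𝔤₁ : Type*}
    [AddCommGroup 𝔤₀] [Module ℝ 𝔤₀] [TopologicalSpace 𝔤₀]
    [AddCommGroup 𝔤₁] [Module ℝ 𝔤₁] [TopologicalSpace 𝔤₁] (L : LieSuperalgebra 𝔤₀ 𝔤₁) {n : ℕ}
    (x : Fin (n + 1) → 𝔤₀ × 𝔤₁) :
    L.monomial x = L.monomial (Fin.init x) * L.ι (x (Fin.last n)) := by
  rw [LieSuperalgebra.monomial, List.ofFn_succ', List.prod_concat]
  rfl

namespace UnitaryRep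

/-! ### Formal adjoints, squares of odd operators, and parity -/

section Basic

variable {G 𝔤₀ 𝔤₁ H : Type*}
  [AddCommGroup 𝔤₀] [Module ℝ 𝔤₀] [TopologicalSpace 𝔤₀]
  [AddCommGroup 𝔤₁] [Module ℝ 𝔤₁] [TopologicalSpace 𝔤₁]
  [Group G] [TopologicalSpace G] [ChartedSpace 𝔤₀ G]
  [NormedAddCommGroup H] [InnerProductSpace ℂ H]
  {r : Regularity} {P : HarishChandraPair G 𝔤₀ 𝔤₁} (R : UnitaryRep r P H)

theorem ρU_ι (x : 𝔤₀ × 𝔤₁) : R.ρU (P.L.ι x) = R.ρ x :=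
  P.L.envLift_ι R.ρ R.ρ_br x

theorem ρU_monomial_succ {n : ℕ} (x : Fin (n + 1) → 𝔤₀ × 𝔤₁) (v : R.vectors) :
    R.ρU (P.L.monomial x) v = R.ρU (P.L.monomial (Fin.init x)) (R.ρ (x (Fin.last n)) v) := by
  rw [P.L.monomial_succ, map_mul, ρU_ι]
  rfl

/-- Differentiate the constant function `⟨π(e^(tx))v, π(e^(tx))w⟩` at `t = 0`. -/
theorem inner_ρ_even (x : 𝔤₀) (v w : R.vectors) :
    inner ℂ (v : H) (R.ρ (x, 0) w : H) = -inner ℂ (R.ρ (x, 0) v : H) (w : H) := by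
  have h := (R.ρ_even x v).inner ℂ (R.ρ_even x w)
  simp only [LinearIsometryEquiv.inner_map_map, zero_smul, P.isExpMap.map_zero, map_one] at h
  have := h.unique (hasDerivAt_const (0 : ℝ) _)
  exact eq_neg_of_add_eq_zero_left this

/-- The phase `e^(-πi/4)` is conjugated in one argument only, so moving it across produces
`e^(πi/4)` squared, which is `i`. -/
theorem inner_ρ_odd (x : 𝔤₁) (v w : R.vectors) :
    inner ℂ (v : H) (R.ρ (0, x) w : H) = Complex.I * inner ℂ (R.ρ (0, x) v : H) (w : H) := by
  have h := R.ρ_odd x v w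
  rw [inner_smul_left, inner_smul_right, ← Complex.exp_conj] at h
  have e1 : (starRingEnd ℂ) (-(Real.pi * Complex.I / 4)) = Real.pi * Complex.I / 4 := by
    simp [Complex.conj_ofReal, map_div₀, Complex.conj_ofNat, neg_div]
  have e2 : Complex.exp (Real.pi * Complex.I / 4) * Complex.exp (Real.pi * Complex.I / 4) =
      Complex.I := by
    rw [← Complex.exp_add]
    refine Eq.trans ?_ Complex.exp_pi_div_two_mul_I
    congr 1
    ring
  have e3 : Complex.exp (Real.pi * Complex.I / 4) * Complex.exp (-(Real.pi * Complex.I / 4)) =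
      1 := by
    rw [← Complex.exp_add, add_neg_cancel, Complex.exp_zero]
  rw [e1] at h
  rw [← e2, mul_assoc, h, ← mul_assoc, e3, one_mul]

theorem π_apply_inv (g : G) (v : H) : R.π g (R.π g⁻¹ v) = v := by
  have h : R.π g * R.π g⁻¹ = 1 := by rw [← map_mul, mul_inv_cancel, map_one]
  exact congrArg (fun e : H ≃ₗᵢ[ℂ] H => e v) h

theorem ρ_eq_add (x : 𝔤₀ × 𝔤₁) (v : R.vectors) :
    R.ρ x v = R.ρ (x.1, 0) v + R.ρ (0, x.2) v := by
  rw [← LinearMap.add_apply, ← map_add]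
  simp

/-- The formal adjoint maps `R.vectors` to itself. It can therefore be iterated along a monomial,
which is what later gives weak continuity. -/
theorem exists_adjoint_ρ (x : 𝔤₀ × 𝔤₁) (u : R.vectors) :
    ∃ u' : R.vectors, ∀ v : R.vectors,
      inner ℂ (u : H) (R.ρ x v : H) = inner ℂ (u' : H) (v : H) := by
  refine ⟨-R.ρ (x.1, 0) u + (-Complex.I) • R.ρ (0, x.2) u, fun v => ?_⟩
  rw [ρ_eq_add]
  simp [inner_ρ_even, inner_ρ_odd, inner_smul_left]

theorem exists_adjoint_monomial {n : ℕ} (x : Fin n → 𝔤₀ × 𝔤₁) (u : R.vectors) :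
    ∃ u' : R.vectors, ∀ v : R.vectors,
      inner ℂ (u : H) (R.ρU (P.L.monomial x) v : H) = inner ℂ (u' : H) (v : H) := by
  induction n with
  | zero => exact ⟨u, fun v => by simp [LieSuperalgebra.monomial]⟩
  | succ n ih =>
    obtain ⟨u', hu'⟩ := ih (Fin.init x)
    obtain ⟨u'', hu''⟩ := R.exists_adjoint_ρ (x (Fin.last n)) u'
    exact ⟨u'', fun v => by rw [ρU_monomial_succ, hu', hu'']⟩

/-- The square of `ρ(x)`, for odd `x`. -/
theorem ρ_br_self_odd (x : 𝔤₁) (v : R.vectors) :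
    R.ρ ((P.L.br (0, x) (0, x)).1, 0) v = (2 : ℂ) • R.ρ (0, x) (R.ρ (0, x) v) := by
  have hx : ((0, x) : 𝔤₀ × 𝔤₁) ∈ homog 𝔤₀ 𝔤₁ 1 := by
    rw [homog, if_neg (by decide)]
    exact ⟨x, rfl⟩
  have hbr := P.L.br_mem 1 1 _ hx _ hx
  rw [homog, if_pos (by decide)] at hbr
  obtain ⟨y, hy⟩ := hbr
  have e : ((P.L.br (0, x) (0, x)).1, (0 : 𝔤₁)) = P.L.br (0, x) (0, x) := by
    rw [← hy]
    rfl
  rw [e, R.ρ_br 1 1 _ hx _ hx, two_smul]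
  simp [sgn]

/-- Up to a phase `ρ(x)` is symmetric, so `‖ρ(x)v‖² = |⟨v, ρ(x)²v⟩|`. As `ρ(x)² = ½ρ([x,x])`,
Cauchy–Schwarz applies; the factor `½` is discarded. -/
theorem norm_ρ_odd_sq_le (x : 𝔤₁) (v : R.vectors) :
    ‖(R.ρ (0, x) v : H)‖ ^ 2 ≤
      ‖(v : H)‖ * ‖(R.ρ ((P.L.br (0, x) (0, x)).1, 0) v : H)‖ := by
  have h1 := R.inner_ρ_odd x v (R.ρ (0, x) v)
  have h2 := congrArg norm h1
  rw [norm_mul, Complex.norm_I, one_mul, inner_self_eq_norm_sq_to_K] at h2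
  simp only [Complex.coe_algebraMap, norm_pow, Complex.norm_real, norm_norm] at h2
  rw [← h2]
  refine (norm_inner_le_norm _ _).trans (mul_le_mul_of_nonneg_left ?_ (norm_nonneg _))
  rw [ρ_br_self_odd, Submodule.coe_smul, norm_smul, Complex.norm_ofNat]
  have := norm_nonneg (R.ρ (0, x) (R.ρ (0, x) v) : H)
  linarith

theorem ρU_mem_part {i j : ZMod 2} {D : P.L.Env} (hD : D ∈ P.L.envParity i) (v : R.vectors)
    (hv : (v : H) ∈ R.grading.part j) : (R.ρU D v : H) ∈ R.grading.part (i + j) := by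
  induction hD using Submodule.span_induction with
  | mem D hD =>
    obtain ⟨n, p, x, hx, rfl, rfl⟩ := hD
    induction n generalizing v j with
    | zero => simpa [LieSuperalgebra.monomial] using hv
    | succ n ih =>
      rw [ρU_monomial_succ, Fin.sum_univ_castSucc, add_assoc]
      exact ih _ (R.ρ_mem _ _ _ (hx _) v hv) (fun k => p k.castSucc) (Fin.init x)
        fun k => hx k.castSucc
  | zero => simp
  | add D D' _ _ h h' => simpa using add_mem h h'
  | smul c D _ h => simpa using Submodule.smul_mem _ c h

theorem inner_eq_zero_of_mem_part {i : ZMod 2} {v w : H} (hw : w ∈ R.grading.part i)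
    (hv : v ∈ R.grading.part (1 + i)) : inner ℂ w v = 0 := by
  fin_cases i
  · exact R.grading.orthogonal w hw v hv
  · exact inner_eq_zero_symm.1 (R.grading.orthogonal v hv w hw)

end Basic

/-! ### Norm continuity of the monomial maps and the superfunction -/

section Frechet

variable {G 𝔤₀ 𝔤₁ H : Type*}
  [AddCommGroup 𝔤₀] [Module ℝ 𝔤₀] [TopologicalSpace 𝔤₀] [IsTopologicalAddGroup 𝔤₀]
  [ContinuousSMul ℝ 𝔤₀] [LocallyConvexSpace ℝ 𝔤₀] [T2Space 𝔤₀] [BaireSpace 𝔤₀]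
  [AddCommGroup 𝔤₁] [Module ℝ 𝔤₁] [TopologicalSpace 𝔤₁]
  [Group G] [TopologicalSpace G] [ChartedSpace 𝔤₀ G]
  [NormedAddCommGroup H] [InnerProductSpace ℂ H] [CompleteSpace H]
  {r : Regularity} {P : HarishChandraPair G 𝔤₀ 𝔤₁} (R : UnitaryRep r P H)

theorem ckOn_orbit (v : R.vectors) {φ : OpenPartialHomeomorph G 𝔤₀} (hφ : φ ∈ atlas 𝔤₀ G)
    (k : ℕ) : CkOn k (fun p => R.π (φ.symm p) (v : H)) φ.target :=
  ((regMap_selfAtlas_iff.1 v.2).2 φ hφ).ckOn φ.open_target k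

/-- The vector `ρ(x)v` is the derivative at `1` of the orbit map in the direction `x`, and the
tangent map of a `C¹` map is continuous. -/
theorem continuous_ρ_even (v : R.vectors) : Continuous fun x : 𝔤₀ => (R.ρ (x, 0) v : H) := by
  set φ := chartAt 𝔤₀ (1 : G) with hφ
  have hC := R.ckOn_orbit v (chart_mem_atlas 𝔤₀ (1 : G)) 1
  have e : (fun x : 𝔤₀ => (R.ρ (x, 0) v : H)) =
      fun x => dirDeriv (fun p => R.π (φ.symm p) (v : H)) (φ 1, x) := by
    funext x
    exact (R.ρ_even x v).unique
      (P.isExpMap.hasDerivAt (f := fun g => R.π g (v : H)) hC x)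
  rw [e, ← continuousOn_univ]
  exact hC.2.2.continuousOn.comp (by fun_prop)
    fun x _ => ⟨φ.map_source (mem_chart_source 𝔤₀ 1), mem_univ _⟩

variable [IsTopologicalAddGroup 𝔤₁]

/-- By additivity, continuity at `0` is enough; there `norm_ρ_odd_sq_le` bounds the norm by the
square root of a continuous function vanishing at `0`. -/
theorem continuous_ρ_odd (v : R.vectors) : Continuous fun x : 𝔤₁ => (R.ρ (0, x) v : H) := by
  let T : 𝔤₁ →+ H :=
    { toFun := fun x => (R.ρ (0, x) v : H)
      map_zero' := by
        rw [Prod.mk_zero_zero, map_zero]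
        rfl
      map_add' := fun x y => by
        have : ((0, x + y) : 𝔤₀ × 𝔤₁) = (0, x) + (0, y) := by simp
        rw [this, map_add]
        rfl }
  refine continuous_of_continuousAt_zero T ?_
  rw [ContinuousAt, map_zero, tendsto_zero_iff_norm_tendsto_zero]
  have hb : Continuous fun x : 𝔤₁ => P.L.br (0, x) (0, x) :=
    P.L.continuous_br.comp (f := fun x : 𝔤₁ => (((0, x), (0, x)) : (𝔤₀ × 𝔤₁) × (𝔤₀ × 𝔤₁)))
      (by fun_prop)
  have hc : Continuous fun x : 𝔤₁ =>
      ‖(v : H)‖ * ‖(R.ρ ((P.L.br (0, x) (0, x)).1, 0) v : H)‖ :=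
    continuous_const.mul ((R.continuous_ρ_even v).comp (continuous_fst.comp hb)).norm
  have h0 := (hc.sqrt).tendsto 0
  have e0 : √(‖(v : H)‖ * ‖(R.ρ ((P.L.br (0, (0 : 𝔤₁)) (0, 0)).1, 0) v : H)‖) = 0 := by
    simp only [Prod.mk_zero_zero, map_zero, Prod.fst_zero, LinearMap.zero_apply,
      ZeroMemClass.coe_zero, norm_zero, mul_zero, Real.sqrt_zero]
  rw [e0] at h0
  exact squeeze_zero (fun x => norm_nonneg _)
    (fun x => Real.le_sqrt_of_sq_le (R.norm_ρ_odd_sq_le x v)) h0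

theorem continuous_ρ (v : R.vectors) : Continuous fun x : 𝔤₀ × 𝔤₁ => (R.ρ x v : H) := by
  have h := ((R.continuous_ρ_even v).comp continuous_fst).add
    ((R.continuous_ρ_odd v).comp (continuous_snd (X := 𝔤₀) (Y := 𝔤₁)))
  refine h.congr fun x => ?_
  rw [R.ρ_eq_add x]
  rfl

/-- With the last factor `y` split off, continuity in `y` holds weakly, by moving the other factors
to the test vector, and hence in norm. Continuity in the other factors is the induction hypothesis
for the vector `ρ(y)v`, so `v` must vary in the induction. -/
theorem continuous_monomial [BarrelledSpace ℝ (𝔤₀ × 𝔤₁)] [FirstCountableTopology 𝔤₀]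
    [FirstCountableTopology 𝔤₁] (n : ℕ) (v : R.vectors) :
    Continuous fun x : Fin n → 𝔤₀ × 𝔤₁ => (R.ρU (P.L.monomial x) v : H) := by
  induction n generalizing v with
  | zero =>
    refine continuous_const (y := (v : H)) |>.congr fun x => ?_
    simp [LieSuperalgebra.monomial]
  | succ n ih =>
    let f : (Fin n → 𝔤₀ × 𝔤₁) → (𝔤₀ × 𝔤₁) →ₗ[ℝ] H := fun x =>
      { toFun := fun y => (R.ρU (P.L.monomial x) (R.ρ y v) : H)
        map_add' := fun y z => by simp
        map_smul' := fun c y => by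
          rw [map_smul]
          simp }
    have hf := continuous_of_separately_of_barrelled f
      (fun x => continuous_of_continuous_inner_of_barrelled R.dense (f x) fun u hu => by
        obtain ⟨u', hu'⟩ := R.exists_adjoint_monomial x ⟨u, hu⟩
        refine Continuous.congr ?_ fun y => (hu' (R.ρ y v)).symm
        exact continuous_const.inner (R.continuous_ρ v))
      fun y => ih (R.ρ y v)
    refine (hf.comp (continuous_finInit.prodMk (continuous_apply (Fin.last n)))).congr fun x => ?_
    rw [ρU_monomial_succ]
    rfl

/-- The `n`-linear map `(x₁, …, x_n) ↦ ρ(x₁) ⋯ ρ(x_n) v`. -/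
theorem exists_continuousMultilinearMap_monomial [BarrelledSpace ℝ (𝔤₀ × 𝔤₁)]
    [FirstCountableTopology 𝔤₀] [FirstCountableTopology 𝔤₁] (n : ℕ) (v : R.vectors) :
    ∃ Ψ : ContinuousMultilinearMap ℝ (fun _ : Fin n => 𝔤₀ × 𝔤₁) H,
      ∀ x, Ψ x = (R.ρU (P.L.monomial x) v : H) := by
  have e : ∀ x : Fin n → 𝔤₀ × 𝔤₁, R.ρU (P.L.monomial x) =
      (MultilinearMap.mkPiAlgebraFin ℝ n (Module.End ℂ R.vectors)).compLinearMap
        (fun _ => R.ρ) x := by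
    intro x
    simp [LieSuperalgebra.monomial, map_list_prod, List.map_ofFn, Function.comp_def, ρU_ι]
  refine ⟨⟨MultilinearMap.mk' (fun x => (R.ρU (P.L.monomial x) v : H)) (fun x i a b => ?_)
    (fun x i c a => ?_), R.continuous_monomial n v⟩, fun x => rfl⟩
  · rw [e, e, e, MultilinearMap.map_update_add]
    rfl
  · rw [e, e, MultilinearMap.map_update_smul]
    rfl

variable [ContinuousSMul ℝ 𝔤₁] [LocallyConvexSpace ℝ 𝔤₁] [T2Space 𝔤₁]

/-- The matrix coefficients of smooth (analytic) unitary representations, as superfunctions. -/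
theorem exists_superfunction [BaireSpace (𝔤₀ × 𝔤₁)] [∀ n : ℕ, BaireSpace (Fin n → 𝔤₀ × 𝔤₁)]
    [FirstCountableTopology 𝔤₀]
    [FirstCountableTopology 𝔤₁] (hG : IsLieGroup r 𝔤₀ G) (v w : R.vectors) (i : ZMod 2)
    (hv : (v : H) ∈ R.grading.part i) (hw : (w : H) ∈ R.grading.part i) :
    ∃ f : Superfunction r P, f.IsEven ∧ f.breve = R.matrixCoeff v w := by
  refine ⟨⟨
    { toFun := fun D g => inner ℂ (w : H) (R.π g (R.ρU D v : H))
      map_add' := fun D D' => by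
        funext g
        simp
      map_smul' := fun c D => by
        funext g
        simp }, fun D => ?_, fun x D g => ?_, fun n => ?_⟩,
    fun g D hD => ?_, rfl⟩
  -- For fixed `D`, this is a functional applied to the orbit map of the single vector `ρ(D)v`.
  -- Smoothness is required in the analytic case too, and `ckOn_orbit` covers both.
  · refine regMap_selfAtlas_iff.2 ⟨?_, fun φ hφ => smoothOn_of_forall_ckOn fun k => ?_⟩
    · exact continuous_const.inner (R.continuous_π _)
    · have hl : CkOn k (innerSL ℂ (w : H)) univ := CkOn.of_contDiffOn isOpen_univ
        (((innerSL ℂ (w : H)).restrictScalars ℝ).contDiff.contDiffOn)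
      exact CkOn.comp (f := innerSL ℂ (w : H)) isOpen_univ φ.open_target hl
        (R.ckOn_orbit (R.ρU D v) hφ k) (mapsTo_univ _ _)
  · have h := (((innerSL ℂ (w : H)).comp
      (R.π g).toContinuousLinearEquiv.toContinuousLinearMap).restrictScalars ℝ).hasFDerivAt
      |>.comp_hasDerivAt (0 : ℝ) (R.ρ_even x (R.ρU D v))
    have e : R.ρU (P.L.ι (x, 0) * D) v = R.ρ (x, 0) (R.ρU D v) := by
      rw [map_mul, ρU_ι]
      rfl
    have e' : (fun t : ℝ => inner ℂ (w : H) (R.π (g * P.exp (t • x)) (R.ρU D v : H))) =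
        fun t => inner ℂ (w : H) (R.π g (R.π (P.exp (t • x)) (R.ρU D v : H))) := by
      funext t
      rw [map_mul]
      rfl
    simp only [LinearMap.coe_mk, AddHom.coe_mk, e, e']
    exact h
  -- Unitarity moves `π(g)` to `w` as `π(g⁻¹)`. The function becomes a real bilinear pairing of a
  -- map of `x` with a map of `g`.
  · obtain ⟨Ψ, hΨ⟩ := R.exists_continuousMultilinearMap_monomial n v
    have hk : RegMap r (atlas 𝔤₀ G) (selfAtlas H) (fun g : G => R.π g⁻¹ (w : H)) :=
      RegMap.comp_of_chartedSpace (f := fun g : G => R.π g (w : H)) w.2 hG.regular_inv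
    have e : (fun p : (Fin n → 𝔤₀ × 𝔤₁) × G =>
        inner ℂ (w : H) (R.π p.2 (R.ρU (P.L.monomial p.1) v : H))) =
        fun p => inner ℂ (R.π p.2⁻¹ (w : H)) (Ψ p.1) := by
      funext p
      rw [hΨ, ← LinearIsometryEquiv.inner_map_map (R.π p.2) _ (R.ρU (P.L.monomial p.1) v : H),
        π_apply_inv]
    simp only [LinearMap.coe_mk, AddHom.coe_mk]
    rw [e]
    rw [regMap_selfAtlas_iff] at hk ⊢
    refine ⟨(hk.1.comp continuous_snd).inner (Ψ.cont.comp continuous_fst), ?_⟩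
    rintro _ ⟨χ, rfl, φ, hφ, rfl⟩
    exact RegOn.bilinear (isBoundedBilinearMap_inner (𝕜 := ℂ) (E := H)).toContinuousLinearMap.flip
      isOpen_univ φ.open_target (RegOn.of_continuousMultilinearMap r Ψ) (hk.2 φ hφ)
  -- For odd `D`, the vector `π(g)ρ(D)v` has the parity opposite to that of `w`, hence is orthogonal
  -- to it.
  · exact R.inner_eq_zero_of_mem_part hw (R.π_mem g _ _ (R.ρU_mem_part hD v hv))

end Frechet

end UnitaryRep

end SuperRep

theorem mainTheorem7 {G 𝔤₀ 𝔤₁ H : Type*}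
    [AddCommGroup 𝔤₀] [Module ℝ 𝔤₀] [UniformSpace 𝔤₀] [IsUniformAddGroup 𝔤₀]
    [ContinuousSMul ℝ 𝔤₀] [LocallyConvexSpace ℝ 𝔤₀] [T2Space 𝔤₀]
    [CompleteSpace 𝔤₀] [(uniformity 𝔤₀).IsCountablyGenerated]
    [AddCommGroup 𝔤₁] [Module ℝ 𝔤₁] [UniformSpace 𝔤₁] [IsUniformAddGroup 𝔤₁]
    [ContinuousSMul ℝ 𝔤₁] [LocallyConvexSpace ℝ 𝔤₁] [T2Space 𝔤₁]
    [CompleteSpace 𝔤₁] [(uniformity 𝔤₁).IsCountablyGenerated]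
    [Group G] [TopologicalSpace G] [ChartedSpace 𝔤₀ G]
    [NormedAddCommGroup H] [InnerProductSpace ℂ H] [CompleteSpace H]
    (P : SuperRep.HarishChandraPair G 𝔤₀ 𝔤₁) :
    (∀ (R : SuperRep.UnitaryRep .smooth P H) (v w : R.vectors) (i : ZMod 2),
      (v : H) ∈ R.grading.part i → (w : H) ∈ R.grading.part i →
        ∃ f : SuperRep.Superfunction .smooth P, f.IsEven ∧ f.breve = R.matrixCoeff v w) ∧
    (P.IsAnalytic →
      ∀ (R : SuperRep.UnitaryRep .analytic P H) (v w : R.vectors) (i : ZMod 2),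
        (v : H) ∈ R.grading.part i → (w : H) ∈ R.grading.part i →
          ∃ f : SuperRep.Superfunction .analytic P, f.IsEven ∧ f.breve = R.matrixCoeff v w) :=
  -- Completeness and metrizability enter here through instances: `𝔤₀`, `𝔤` and the finite powers of
  -- `𝔤` are Baire, `𝔤` is hence barrelled, and both parts are first countable.
  ⟨fun R v w i hv hw => R.exists_superfunction P.isLieGroup v w i hv hw,
    fun hP R v w i hv hw => R.exists_superfunction hP.isLieGroup v w i hv hw⟩
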